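/- **Setting.** Let $(\mathbf{x}_t,y_t)_{t\ge0}$ be i.i.d. random pairs in $\mathbb{R}^d\times\mathbb{R}$ on a probability space such that, almost surely, $\|\mathbf{x}_t\|\le1$, $y_t\in\{\pm1\}$ and $\langle\mathbf{w}_*,y_t\mathbf{x}_t\rangle\ge\gamma$, for some unit vector $\mathbf{w}_*$ and some $\gamma>0$. Let $\phi:\mathbb{R}\to\mathbb{R}\cup\{\infty\}$ be convex with effective domain contained in $[0,1]$, $\phi(0)=\phi(1)=0$, $\phi(1-\mu)=\phi(\mu)$, strictly convex on its domain, twice continuously differentiable on $(0,1)$ with $\phi''>0$ there. Let $\ell(z)=\phi^*(-z)=\sup_{\mu}\{-z\mu-\phi(\mu)\}$ be the Fenchel–Young loss generated by $\phi$ and $g=|\ell'|$. Assume that $\min_{z}\{\lambda\ell(z)+z^2\}$ exists for all $\lambda\ge1$, that $g\le C_g$ for some $C_g>0$, and that $\ell$ has separation margin $m>0$, i.e. $m$ is the smallest positive number with $\ell(z)=0$ for all $z\ge m$. Online SGD with stepsize $\eta>0$ is $\mathbf{w}_0=\mathbf{0}$, $\mathbf{w}_{t+1}=\mathbf{w}_t-\eta\nabla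 L_t(\mathbf{w}_t)$, where $L_t(\mathbf{w})=\ell(\langle\mathbf{w},y_t\mathbf{x}_t\rangle)$. Write $\mathbb{E}_t[L_t(\mathbf{w}_t)]$ for the expectation over the fresh sample $(\mathbf{x}_t,y_t)$ only, i.e. the population risk $R(\mathbf{w})=\mathbb{E}[\ell(\langle\mathbf{w},y\mathbf{x}\rangle)]$ evaluated at the random iterate $\mathbf{w}=\mathbf{w}_t$. **Constants.** For $\bar\epsilon\in(0,1)$ let $\bar\mu=\min\{g(\ell^{-1}(\bar\epsilon)),1\}$ and $$\alpha=\sup_{\mu\in(0,\bar\mu],\ \mu<1}\frac{\phi'(\mu)}{\mu\phi''(\mu)}\left[1-\frac{\phi(\mu)}{\mu\phi'(\mu)}\right]=\sup_{\mu\in(0,\bar\mu],\ \mu<1}\frac{\mu\phi'(\mu)-\phi(\mu)}{\mu^2\phi''(\mu)},\qquad C_\phi=\frac{\bar\mu}{[\bar\mu\phi'(\bar\mu)-\phi(\bar\mu)]^\alpha},$$ where the last bracket is to be read as $\bar\epsilon$ if $\bar\mu=1$ (it equals $\bar\epsilon$ whenever $\bar\mu<1$). The second form of $\alpha$ is the one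 meant where $\phi'(\mu)=0$. **Proposition.** Assume $\alpha,C_\phi\in(0,\infty)$, let $\delta\in(0,1)$ and $\epsilon\in(0,\bar\epsilon)$, and put $$M=\ell\left(-\frac{4m+\eta C_g}{\gamma}\right),\quad t^\circ=\max\left\{1,\ \frac{32M^2\ln(1/\delta)}{\epsilon^2},\ \frac{8M\ln(1/\delta)}{\epsilon}\right\},\quad N=\frac{2^\alpha}{C_\phi\gamma^2}\left(\frac{4m}{\eta}+C_g\right)\epsilon^{-\alpha}.$$ If $T\in\mathbb{N}$ satisfies $T>N\,t^\circ$, then with probability at least $(1-\delta)^N$ one has $\min_{1\le t\le T}\mathbb{E}_t[L_t(\mathbf{w}_t)]\le\epsilon$. -/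

import Mathlib

open MeasureTheory ProbabilityTheory

noncomputable section

namespace FenchelYoung

/-- Binary potentials `φ : ℝ → ℝ ∪ {∞}` (write `φ μ = Ω (μ, 1 - μ)`): the effective domain lies in
the simplex, i.e. in `[0, 1]`; zero entropy at the vertices; convexity; symmetry. -/
structure IsBinaryPotential (φ : ℝ → EReal) : Prop where
  ne_bot : ∀ μ, φ μ ≠ ⊥
  dom_subset : ∀ μ, φ μ ≠ ⊤ → μ ∈ Set.Icc (0 : ℝ) 1
  zero_left : φ 0 = 0
  zero_right : φ 1 = 0
  convex : ∀ μ ν a : ℝ, μ ≠ ν → 0 < a → a < 1 →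
    φ ((1 - a) * μ + a * ν) ≤ ((1 - a : ℝ) : EReal) * φ μ + (a : EReal) * φ ν
  symm : ∀ μ, φ (1 - μ) = φ μ

/-- The real-valued version of `φ`, used on the effective domain only. -/
def realPart (φ : ℝ → EReal) (μ : ℝ) : ℝ := (φ μ).toReal

/-- Binary potentials that are moreover `C²` on `(0, 1)`, strictly convex, and have `φ'' > 0`
on `(0, 1)`. -/
structure IsRegularPotential (φ : ℝ → EReal) : Prop extends IsBinaryPotential φ where
  contDiffOn : ContDiffOn ℝ 2 (realPart φ) (Set.Ioo 0 1)
  strictConvexOn : StrictConvexOn ℝ {μ | φ μ ≠ ⊤} (realPart φ)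
  deriv_deriv_pos : ∀ μ ∈ Set.Ioo (0 : ℝ) 1, 0 < deriv (deriv (realPart φ)) μ

/-- The convex conjugate `φ*(θ) = sup_μ (θ μ - φ μ)`. -/
def conjugate (φ : ℝ → EReal) (θ : ℝ) : EReal := ⨆ μ : ℝ, (((θ * μ : ℝ) : EReal) - φ μ)

/-- The margin-based Fenchel–Young loss `ℓ(z) = φ*(-z)`; the conjugate of a binary potential is
finite everywhere. -/
def loss (φ : ℝ → EReal) (z : ℝ) : ℝ := (conjugate φ (-z)).toReal

/-- `g(z) = |ℓ'(z)|`. -/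
def absSlope (ℓ : ℝ → ℝ) (z : ℝ) : ℝ := |deriv ℓ z|

/-- The standing assumptions on the Fenchel–Young loss `ℓ` generated by `φ`: the potential is
regular, `ρ(r) = min_z (r ℓ(z) + z²)` is well defined for `r ≥ 1`, and `|ℓ'| ≤ Cg`. -/
structure LossAssumption (φ : ℝ → EReal) (Cg : ℝ) : Prop where
  potential : IsRegularPotential φ
  regular : ∀ r : ℝ, 1 ≤ r → ∃ ρ : ℝ, IsLeast (Set.range fun z : ℝ => r * loss φ z + z ^ 2) ρ
  Cg_pos : 0 < Cg
  lipschitz : ∀ z, absSlope (loss φ) z ≤ Cg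

/-- `m` is the separation margin of `ℓ`: the smallest `m > 0` with `ℓ(z) = 0` for all `z ≥ m`. -/
def IsSeparationMargin (ℓ : ℝ → ℝ) (m : ℝ) : Prop :=
  IsLeast {m' : ℝ | 0 < m' ∧ ∀ z, m' ≤ z → ℓ z = 0} m

/-- `μ̄ = min {g(ℓ⁻¹(ε̄)), 1}`. For the losses in question and `ε̄ > 0` there is exactly one `z`
with `ℓ(z) = ε̄`, so any inverse function computes it. -/
def muBar (φ : ℝ → EReal) (epsBar : ℝ) : ℝ :=
  min (absSlope (loss φ) (Function.invFun (loss φ) epsBar)) 1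

/-- `φ'(μ) / (μ φ''(μ)) * [1 - φ(μ) / (μ φ'(μ))]`, multiplied out so that it also makes sense at
the zero `μ = 1/2` of `φ'`. -/
def localExponent (φ : ℝ → EReal) (μ : ℝ) : ℝ :=
  (μ * deriv (realPart φ) μ - realPart φ μ) / (μ ^ 2 * deriv (deriv (realPart φ)) μ)

/-- `α` is the (finite) supremum of the local exponent over `μ ∈ (0, μ̄]`; the point `μ = 1`, where
`φ` need not be differentiable, is left out. -/
def IsExponent (φ : ℝ → EReal) (epsBar α : ℝ) : Prop :=
  IsLUB (localExponent φ '' {μ : ℝ | 0 < μ ∧ μ ≤ muBar φ epsBar ∧ μ < 1}) α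

open Classical in
/-- `C_φ = μ̄ / [μ̄ φ'(μ̄) - φ(μ̄)] ^ α`. If `μ̄ = 1`, then `φ'(μ̄)` makes no sense and the bracket
stands for `ε̄`, the value that it has whenever `μ̄ < 1`. -/
def constC (φ : ℝ → EReal) (epsBar α : ℝ) : ℝ :=
  muBar φ epsBar /
    (if muBar φ epsBar < 1 then
      muBar φ epsBar * deriv (realPart φ) (muBar φ epsBar) - realPart φ (muBar φ epsBar)
    else epsBar) ^ α

/-- The loss `w ↦ ℓ(⟨w, y x⟩)` of a linear classifier on a single sample `(x, y)`. -/
def sampleLoss {d : ℕ} (ℓ : ℝ → ℝ) (x : EuclideanSpace ℝ (Fin d)) (y : ℝ)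
    (w : EuclideanSpace ℝ (Fin d)) : ℝ :=
  ℓ (inner ℝ w (y • x))

/-- Online SGD from `w₀ = 0` along the sample sequence `(x t, y t)`:
`w_{t+1} = w_t - η ∇L_t(w_t)` with `L_t(w) = ℓ(⟨w, y_t x_t⟩)`. -/
def sgd {d : ℕ} (ℓ : ℝ → ℝ) (η : ℝ) (x : ℕ → EuclideanSpace ℝ (Fin d)) (y : ℕ → ℝ) :
    ℕ → EuclideanSpace ℝ (Fin d)
  | 0 => 0
  | t + 1 => sgd ℓ η x y t - η • gradient (sampleLoss ℓ (x t) (y t)) (sgd ℓ η x y t)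

/-- The data: i.i.d. samples `(x t, y t)` with `‖x t‖ ≤ 1` and `y t = ±1` almost surely, linearly
separated with margin `γ > 0` by the unit vector `wStar`. -/
structure DataAssumption {Ω : Type*} [MeasurableSpace Ω] (P : Measure Ω) {d : ℕ}
    (x : ℕ → Ω → EuclideanSpace ℝ (Fin d)) (y : ℕ → Ω → ℝ)
    (wStar : EuclideanSpace ℝ (Fin d)) (γ : ℝ) : Prop where
  measurable_x : ∀ t, Measurable (x t)
  measurable_y : ∀ t, Measurable (y t)
  indep : iIndepFun (fun t ω => (x t ω, y t ω)) P
  identDistrib : ∀ t, IdentDistrib (fun ω => (x t ω, y t ω)) (fun ω => (x 0 ω, y 0 ω)) P P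
  norm_le_one : ∀ t, ∀ᵐ ω ∂P, ‖x t ω‖ ≤ 1
  label : ∀ t, ∀ᵐ ω ∂P, y t ω = 1 ∨ y t ω = -1
  norm_wStar : ‖wStar‖ = 1
  margin_pos : 0 < γ
  separable : ∀ t, ∀ᵐ ω ∂P, γ ≤ inner ℝ wStar (y t ω • x t ω)

/-- `E[L_t(w)]` for a fixed `w`, the expectation over the fresh `t`-th sample: the population risk
of `w`. At `w = w_t`, which depends on the samples before `t` only, this is the conditional
expectation of `L_t(w_t)` given these samples. -/
def expectedLoss {Ω : Type*} [MeasurableSpace Ω] (P : Measure Ω) {d : ℕ} (ℓ : ℝ → ℝ)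
    (x : ℕ → Ω → EuclideanSpace ℝ (Fin d)) (y : ℕ → Ω → ℝ) (t : ℕ)
    (w : EuclideanSpace ℝ (Fin d)) : ℝ :=
  ∫ ω, sampleLoss ℓ (x t ω) (y t ω) w ∂P

/-- `M_{η,γ} = ℓ(-(4m + η C_g) / γ)`. -/
def lossBound (ℓ : ℝ → ℝ) (m Cg η γ : ℝ) : ℝ := ℓ (-((4 * m + η * Cg) / γ))

/-- `t° = max {32 M² ln(1/δ) / ε², 8 M ln(1/δ) / ε}`, but at least one iteration: it is the length
of a block of iterations. -/
def blockLength (M δ ε : ℝ) : ℝ :=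
  max 1 (max (32 * M ^ 2 * Real.log (1 / δ) / ε ^ 2) (8 * M * Real.log (1 / δ) / ε))

/-- `N = 2^α / (C_φ γ²) * (4m / η + C_g) * ε^{-α}`. -/
def blockCount (α C γ m η Cg ε : ℝ) : ℝ :=
  2 ^ α / (C * γ ^ 2) * (4 * m / η + Cg) * ε ^ (-α)

end FenchelYoung

end

/-! Write `g` for the absolute slope of the loss and `v` for a signed sample `y • x`. Every SGD step
adds `η g v` to the iterate, so the perceptron argument applies: the component along `wStar` grows
at least like `γ η ∑ g`, while `‖w‖ ^ 2` grows at most like `(2 m + η Cg) η ∑ g`, because `g`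
vanishes on margins above `m`. Hence `γ ^ 2 η ∑ g ≤ 4 m + η Cg`, and all iterates stay in the ball
of radius `B = (4 m + η Cg) / γ`, where sample losses are at most `M = ℓ (-B)`
(`perceptron_bounds`).

A sample of loss at least `ε / 2` has slope at least `a = C_φ (ε / 2) ^ α` (`constC_mul_rpow_le`),
and `N` is exactly the slope budget divided by `a`: at most `N` such samples can occur. But while
the risk exceeds `ε`, each fresh sample is of this kind with conditional probability at least `p = ε
/ (2 M)` (`le_measureReal_of_lt_integral`).

The number of such samples therefore dominates a binomial count until the risk drops to `ε`; this
comparison is made by dynamic programming with binomial tails as value functions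
(`binomialTail_le_integral_sgdStep`, `integral_le_integral_of_step`). Cutting `T` trials into `⌊N⌋ +
1` blocks shows that the binomial count exceeds `N` with probability at least `(1 - δ) ^ N`
(`rpow_le_binomialTail`), and on that event the risk must have reached `ε`. -/

namespace FenchelYoung

open Set Filter Topology

/-! ### Convex duality: the loss, its slope, and the loss as a function of the slope. -/

section Potential

variable {φ : ℝ → EReal}

theorem IsBinaryPotential.le_zero (h : IsBinaryPotential φ) {μ : ℝ} (hμ : μ ∈ Icc (0 : ℝ) 1) :
    φ μ ≤ 0 := by
  rcases hμ.1.eq_or_lt with rfl | h0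
  · exact h.zero_left.le
  rcases hμ.2.eq_or_lt with rfl | h1
  · exact h.zero_right.le
  have := h.convex 0 1 μ zero_ne_one h0 h1
  simpa [h.zero_left, h.zero_right] using this

theorem IsBinaryPotential.coe_realPart (h : IsBinaryPotential φ) {μ : ℝ}
    (hμ : μ ∈ Icc (0 : ℝ) 1) : ((realPart φ μ : ℝ) : EReal) = φ μ :=
  EReal.coe_toReal (ne_top_of_le_ne_top EReal.zero_ne_top (h.le_zero hμ)) (h.ne_bot μ)

theorem IsBinaryPotential.realPart_nonpos (h : IsBinaryPotential φ) {μ : ℝ}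
    (hμ : μ ∈ Icc (0 : ℝ) 1) : realPart φ μ ≤ 0 := by
  have := h.le_zero hμ
  rw [← h.coe_realPart hμ] at this
  exact_mod_cast this

theorem IsBinaryPotential.dom_eq (h : IsBinaryPotential φ) : {μ | φ μ ≠ ⊤} = Icc (0 : ℝ) 1 :=
  Subset.antisymm h.dom_subset
    fun _ hμ => ne_top_of_le_ne_top EReal.zero_ne_top (h.le_zero hμ)

theorem IsBinaryPotential.realPart_zero (h : IsBinaryPotential φ) : realPart φ 0 = 0 := by
  simp [realPart, h.zero_left]

theorem IsBinaryPotential.realPart_one (h : IsBinaryPotential φ) : realPart φ 1 = 0 := by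
  simp [realPart, h.zero_right]

theorem IsBinaryPotential.realPart_symm (h : IsBinaryPotential φ) (μ : ℝ) :
    realPart φ (1 - μ) = realPart φ μ := by
  simp [realPart, h.symm]

theorem IsRegularPotential.strictConvexOn_Icc (h : IsRegularPotential φ) :
    StrictConvexOn ℝ (Icc 0 1) (realPart φ) :=
  h.dom_eq ▸ h.strictConvexOn

theorem IsRegularPotential.half_le (h : IsRegularPotential φ) {μ : ℝ} (hμ : μ ∈ Icc (0 : ℝ) 1) :
    realPart φ (1 / 2) ≤ realPart φ μ := by
  have hμ' : 1 - μ ∈ Icc (0 : ℝ) 1 := ⟨by linarith [hμ.2], by linarith [hμ.1]⟩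
  have := h.strictConvexOn_Icc.convexOn.2 hμ hμ' (by norm_num : (0 : ℝ) ≤ 1 / 2)
    (by norm_num : (0 : ℝ) ≤ 1 / 2) (by norm_num)
  simp only [smul_eq_mul, h.realPart_symm] at this
  rw [show 1 / 2 * μ + 1 / 2 * (1 - μ) = (1 / 2 : ℝ) by ring] at this
  linarith

/-- The loss is the least upper bound of the affine functions `z ↦ -z μ - φ μ`. -/
theorem IsRegularPotential.isLUB_loss (h : IsRegularPotential φ) (z : ℝ) :
    IsLUB ((fun μ => -z * μ - realPart φ μ) '' Icc 0 1) (loss φ z) := by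
  have hterm : ∀ μ ∈ Icc (0 : ℝ) 1,
      ((-z * μ : ℝ) : EReal) - φ μ = ((-z * μ - realPart φ μ : ℝ) : EReal) := by
    intro μ hμ
    rw [← h.coe_realPart hμ, EReal.coe_sub]
  have hle : ∀ c : ℝ, (∀ μ ∈ Icc (0 : ℝ) 1, -z * μ - realPart φ μ ≤ c) →
      conjugate φ (-z) ≤ c := by
    intro c hc
    refine iSup_le fun μ => ?_
    by_cases hμ : φ μ = ⊤
    · simp [hμ]
    · rw [hterm μ (h.dom_subset μ hμ)]
      exact_mod_cast hc μ (h.dom_subset μ hμ)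
  have hge : ∀ μ ∈ Icc (0 : ℝ) 1, ((-z * μ - realPart φ μ : ℝ) : EReal) ≤ conjugate φ (-z) := by
    intro μ hμ
    rw [← hterm μ hμ]
    exact le_iSup (fun μ : ℝ => ((-z * μ : ℝ) : EReal) - φ μ) μ
  have htop : conjugate φ (-z) ≠ ⊤ := by
    refine ne_top_of_le_ne_top (EReal.coe_ne_top (|z| - realPart φ (1 / 2))) (hle _ fun μ hμ => ?_)
    have h1 : -z * μ ≤ |z| := by
      calc -z * μ ≤ |z| * μ := mul_le_mul_of_nonneg_right (neg_le_abs z) hμ.1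
        _ ≤ |z| := mul_le_of_le_one_right (abs_nonneg z) hμ.2
    linarith [h.half_le hμ]
  have hbot : conjugate φ (-z) ≠ ⊥ :=
    ne_bot_of_le_ne_bot (EReal.coe_ne_bot _) (hge 0 (by simp))
  have hcoe : ((loss φ z : ℝ) : EReal) = conjugate φ (-z) := EReal.coe_toReal htop hbot
  constructor
  · rintro _ ⟨μ, hμ, rfl⟩
    have := hge μ hμ
    rw [← hcoe] at this
    exact_mod_cast this
  · intro c hc
    have := hle c fun μ hμ => hc ⟨μ, hμ, rfl⟩
    rw [← hcoe] at this
    exact_mod_cast this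

theorem IsRegularPotential.le_loss (h : IsRegularPotential φ) (z : ℝ) {μ : ℝ}
    (hμ : μ ∈ Icc (0 : ℝ) 1) : -z * μ - realPart φ μ ≤ loss φ z :=
  (h.isLUB_loss z).1 ⟨μ, hμ, rfl⟩

theorem IsRegularPotential.loss_nonneg (h : IsRegularPotential φ) (z : ℝ) : 0 ≤ loss φ z := by
  simpa [h.realPart_zero] using h.le_loss z (μ := 0) (by simp)

theorem IsRegularPotential.neg_le_loss (h : IsRegularPotential φ) (z : ℝ) : -z ≤ loss φ z := by
  simpa [h.realPart_one] using h.le_loss z (μ := 1) (by simp)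

/-- Convexity alone would allow jumps at the endpoints. A zero of the loss excludes them: `-m μ ≤ φ
μ ≤ 0` squeezes `φ` at `0`, and symmetry transfers this to `1`. This is what makes the supremum in
the loss attained. -/
theorem IsRegularPotential.continuousOn_Icc (h : IsRegularPotential φ) {m : ℝ}
    (hm : loss φ m = 0) : ContinuousOn (realPart φ) (Icc 0 1) := by
  have h0 : ContinuousWithinAt (realPart φ) (Icc 0 1) 0 := by
    rw [ContinuousWithinAt, h.realPart_zero]
    have hl : Tendsto (fun μ : ℝ => -m * μ) (𝓝[Icc 0 1] 0) (𝓝 0) := by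
      have : Continuous fun μ : ℝ => -m * μ := by fun_prop
      simpa using (this.tendsto 0).mono_left nhdsWithin_le_nhds
    refine tendsto_of_tendsto_of_tendsto_of_le_of_le' hl tendsto_const_nhds ?_ ?_
    · filter_upwards [self_mem_nhdsWithin] with μ hμ
      linarith [h.le_loss m hμ]
    · filter_upwards [self_mem_nhdsWithin] with μ hμ using h.realPart_nonpos hμ
  intro μ hμ
  rcases hμ.1.eq_or_lt with rfl | hμ0
  · exact h0
  rcases hμ.2.eq_or_lt with rfl | hμ1
  · have hs : realPart φ = realPart φ ∘ fun μ => 1 - μ := by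
      ext μ
      exact (h.realPart_symm μ).symm
    rw [hs]
    refine ContinuousWithinAt.comp (t := Icc 0 1) (by simpa using h0) (by fun_prop) ?_
    intro μ hμ
    exact ⟨by linarith [hμ.2], by linarith [hμ.1]⟩
  · exact ((h.contDiffOn.continuousOn.continuousAt
      (Ioo_mem_nhds hμ0 hμ1))).continuousWithinAt

/-- `μ` is a maximizer in the definition of `ℓ(z)`. -/
def IsDual (φ : ℝ → EReal) (z μ : ℝ) : Prop :=
  μ ∈ Icc (0 : ℝ) 1 ∧ loss φ z = -z * μ - realPart φ μ

theorem IsRegularPotential.isDual_of_forall_le (h : IsRegularPotential φ) {z μ : ℝ}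
    (hμ : μ ∈ Icc (0 : ℝ) 1)
    (hmax : ∀ ν ∈ Icc (0 : ℝ) 1, -z * ν - realPart φ ν ≤ -z * μ - realPart φ μ) :
    IsDual φ z μ := by
  refine ⟨hμ, le_antisymm ((h.isLUB_loss z).2 ?_) (h.le_loss z hμ)⟩
  rintro _ ⟨ν, hν, rfl⟩
  exact hmax ν hν

theorem IsRegularPotential.exists_isDual (h : IsRegularPotential φ) {m : ℝ}
    (hm : loss φ m = 0) (z : ℝ) : ∃ μ, IsDual φ z μ := by
  have hc : ContinuousOn (fun μ => -z * μ - realPart φ μ) (Icc 0 1) :=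
    ContinuousOn.sub (by fun_prop) (h.continuousOn_Icc hm)
  obtain ⟨μ, hμ, hmax⟩ := isCompact_Icc.exists_isMaxOn (nonempty_Icc.2 zero_le_one) hc
  exact ⟨μ, h.isDual_of_forall_le hμ hmax⟩

theorem IsDual.unique (h : IsRegularPotential φ) {z μ ν : ℝ} (hμ : IsDual φ z μ)
    (hν : IsDual φ z ν) : μ = ν := by
  by_contra hne
  have hlt := h.strictConvexOn_Icc.2 hμ.1 hν.1 hne (by norm_num : (0 : ℝ) < 1 / 2)
    (by norm_num : (0 : ℝ) < 1 / 2) (by norm_num)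
  have hmem := h.strictConvexOn_Icc.1 hμ.1 hν.1 (by norm_num : (0 : ℝ) ≤ 1 / 2)
    (by norm_num : (0 : ℝ) ≤ 1 / 2) (by norm_num)
  have := h.le_loss z hmem
  have h1 := hμ.2
  have h2 := hν.2
  simp only [smul_eq_mul] at *
  nlinarith

/-- The subgradient inequality: `-μ` is a subgradient of the loss at `z`. -/
theorem IsDual.loss_sub_le (h : IsRegularPotential φ) {z μ : ℝ} (hμ : IsDual φ z μ) (z' : ℝ) :
    loss φ z - (z' - z) * μ ≤ loss φ z' := by
  have := h.le_loss z' hμ.1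
  rw [hμ.2]
  linarith

theorem IsDual.antitone (h : IsRegularPotential φ) {z z' μ μ' : ℝ} (hμ : IsDual φ z μ)
    (hμ' : IsDual φ z' μ') (hz : z ≤ z') : μ' ≤ μ := by
  rcases hz.eq_or_lt with rfl | hz
  · exact (hμ'.unique h hμ).le
  have h1 := hμ.loss_sub_le h z'
  have h2 := hμ'.loss_sub_le h z
  by_contra! hlt
  nlinarith [mul_pos (sub_pos.2 hz) (sub_pos.2 hlt)]

/-- Continuity of the maximizer. By compactness and uniqueness, the objective at `z` stays below its
maximum by a positive gap outside the ball around `μ`, and moving `z` by less than half the gap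
cannot bring a maximizer there. -/
theorem IsDual.eventually_near (h : IsRegularPotential φ) {m : ℝ} (hm : loss φ m = 0) {z μ : ℝ}
    (hμ : IsDual φ z μ) {c : ℝ} (hc : 0 < c) :
    ∀ᶠ z' in 𝓝 z, ∀ μ', IsDual φ z' μ' → |μ' - μ| < c := by
  have hcont : ContinuousOn (fun μ => -z * μ - realPart φ μ) (Icc 0 1 \ Metric.ball μ c) :=
    (ContinuousOn.sub (by fun_prop) (h.continuousOn_Icc hm)).mono sdiff_subset
  have hK : IsCompact (Icc 0 1 \ Metric.ball μ c) := isCompact_Icc.diff Metric.isOpen_ball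
  rcases (Icc 0 1 \ Metric.ball μ c).eq_empty_or_nonempty with hE | hE
  · refine Eventually.of_forall fun z' μ' hμ' => ?_
    by_contra hfar
    have : μ' ∈ Icc 0 1 \ Metric.ball μ c := ⟨hμ'.1, by simpa [Real.dist_eq] using hfar⟩
    simp [hE] at this
  obtain ⟨κ, hκ, hmax⟩ := hK.exists_isMaxOn hE hcont
  have hgap : -z * κ - realPart φ κ < loss φ z := by
    refine lt_of_le_of_ne (h.le_loss z hκ.1) fun heq => hκ.2 ?_
    rw [IsDual.unique h ⟨hκ.1, heq.symm⟩ hμ]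
    exact Metric.mem_ball_self hc
  have hev : ∀ᶠ z' in 𝓝 z, |z' - z| < (loss φ z - (-z * κ - realPart φ κ)) / 2 := by
    have := Metric.ball_mem_nhds z (half_pos (sub_pos.2 hgap))
    filter_upwards [this] with z' hz' using hz'
  filter_upwards [hev] with z' hz' μ' hμ'
  by_contra hfar
  have h1 : -z * μ' - realPart φ μ' ≤ -z * κ - realPart φ κ :=
    hmax ⟨hμ'.1, by simpa [Real.dist_eq] using hfar⟩
  have h2 := hμ.loss_sub_le h z'
  have h3 := hμ'.2
  have h4 : (z' - z) * (μ - μ') ≤ |z' - z| := by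
    calc (z' - z) * (μ - μ') ≤ |(z' - z) * (μ - μ')| := le_abs_self _
      _ = |z' - z| * |μ - μ'| := abs_mul _ _
      _ ≤ |z' - z| * 1 := by
        gcongr
        rw [abs_le]
        constructor <;> linarith [hμ.1.1, hμ.1.2, hμ'.1.1, hμ'.1.2]
      _ = |z' - z| := mul_one _
  nlinarith [abs_nonneg (z' - z)]

/-- The envelope theorem: the subgradient inequalities at `z` and at `z'` bound the remainder by
`|μ' - μ| * |z' - z|`. -/
theorem IsDual.hasDerivAt (h : IsRegularPotential φ) {m : ℝ} (hm : loss φ m = 0) {z μ : ℝ}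
    (hμ : IsDual φ z μ) : HasDerivAt (loss φ) (-μ) z := by
  rw [hasDerivAt_iff_isLittleO, Asymptotics.isLittleO_iff]
  intro c hc
  filter_upwards [hμ.eventually_near h hm hc] with z' hz'
  obtain ⟨μ', hμ'⟩ := h.exists_isDual hm z'
  have h1 := hμ.loss_sub_le h z'
  have h2 := hμ'.loss_sub_le h z
  have h3 : (z' - z) * (μ - μ') ≤ c * |z' - z| := by
    calc (z' - z) * (μ - μ') ≤ |(z' - z) * (μ - μ')| := le_abs_self _
      _ = |μ' - μ| * |z' - z| := by rw [abs_mul, abs_sub_comm μ, mul_comm]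
      _ ≤ c * |z' - z| := by gcongr; exact (hz' μ' hμ').le
  rw [Real.norm_eq_abs, Real.norm_eq_abs, abs_le, smul_eq_mul]
  constructor
  · nlinarith [mul_nonneg hc.le (abs_nonneg (z' - z))]
  · nlinarith

theorem IsDual.absSlope_eq (h : IsRegularPotential φ) {m : ℝ} (hm : loss φ m = 0) {z μ : ℝ}
    (hμ : IsDual φ z μ) : absSlope (loss φ) z = μ := by
  rw [absSlope, (hμ.hasDerivAt h hm).deriv, abs_neg, abs_of_nonneg hμ.1.1]

/-- Identifies the slope with the dual maximizer, so that facts about `φ` at `μ` become facts about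
the slope of the loss. -/
theorem IsRegularPotential.isDual_absSlope (h : IsRegularPotential φ) {m : ℝ}
    (hm : loss φ m = 0) (z : ℝ) : IsDual φ z (absSlope (loss φ) z) := by
  obtain ⟨μ, hμ⟩ := h.exists_isDual hm z
  rwa [hμ.absSlope_eq h hm]

theorem IsRegularPotential.hasDerivAt_loss (h : IsRegularPotential φ) {m : ℝ}
    (hm : loss φ m = 0) (z : ℝ) : HasDerivAt (loss φ) (-absSlope (loss φ) z) z :=
  (h.isDual_absSlope hm z).hasDerivAt h hm

theorem IsRegularPotential.antitone_absSlope (h : IsRegularPotential φ) {m : ℝ}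
    (hm : loss φ m = 0) : Antitone (absSlope (loss φ)) := fun z z' hz =>
  (h.isDual_absSlope hm z).antitone h (h.isDual_absSlope hm z') hz

theorem IsRegularPotential.continuous_loss (h : IsRegularPotential φ) {m : ℝ}
    (hm : loss φ m = 0) : Continuous (loss φ) :=
  continuous_iff_continuousAt.2 fun z => (h.hasDerivAt_loss hm z).continuousAt

theorem IsRegularPotential.antitone_loss (h : IsRegularPotential φ) {m : ℝ}
    (hm : loss φ m = 0) : Antitone (loss φ) :=
  antitone_of_deriv_nonpos (fun z => (h.hasDerivAt_loss hm z).differentiableAt) fun z => by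
    rw [(h.hasDerivAt_loss hm z).deriv]
    exact neg_nonpos.2 (abs_nonneg _)

theorem IsRegularPotential.absSlope_eq_zero (h : IsRegularPotential φ) {z : ℝ}
    (hz : loss φ z = 0) : absSlope (loss φ) z = 0 :=
  IsDual.absSlope_eq h hz ⟨by simp, by simp [hz, h.realPart_zero]⟩

theorem IsRegularPotential.absSlope_pos (h : IsRegularPotential φ) {m z : ℝ}
    (hm : loss φ m = 0) (hz : 0 < loss φ z) : 0 < absSlope (loss φ) z := by
  refine lt_of_le_of_ne (abs_nonneg _) fun h0 => hz.ne' ?_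
  have := (h.isDual_absSlope hm z).2
  rw [this, ← h0, h.realPart_zero]
  ring

theorem IsRegularPotential.exists_loss_eq (h : IsRegularPotential φ) {m c : ℝ}
    (hm : loss φ m = 0) (hc : 0 ≤ c) : ∃ z, loss φ z = c := by
  have h1 : c ∈ Icc (loss φ m) (loss φ (-c)) := ⟨by rwa [hm], by simpa using h.neg_le_loss (-c)⟩
  exact mem_range_of_exists_le_of_exists_ge (h.continuous_loss hm) ⟨m, h1.1⟩ ⟨-c, h1.2⟩

theorem IsRegularPotential.differentiableAt (h : IsRegularPotential φ) {μ : ℝ}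
    (hμ : μ ∈ Ioo (0 : ℝ) 1) : DifferentiableAt ℝ (realPart φ) μ :=
  (h.contDiffOn.differentiableOn (by norm_num)).differentiableAt (Ioo_mem_nhds hμ.1 hμ.2)

theorem IsRegularPotential.differentiableAt_deriv (h : IsRegularPotential φ) {μ : ℝ}
    (hμ : μ ∈ Ioo (0 : ℝ) 1) : DifferentiableAt ℝ (deriv (realPart φ)) μ := by
  have : ContDiffOn ℝ 1 (deriv (realPart φ)) (Ioo 0 1) :=
    h.contDiffOn.deriv_of_isOpen isOpen_Ioo (by norm_num)
  exact (this.differentiableOn (by norm_num)).differentiableAt (Ioo_mem_nhds hμ.1 hμ.2)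

theorem IsDual.deriv_eq (h : IsRegularPotential φ) {z μ : ℝ} (hμ : IsDual φ z μ)
    (hμ' : μ ∈ Ioo (0 : ℝ) 1) : deriv (realPart φ) μ = -z := by
  have hmax : IsLocalMax (fun ν => -z * ν - realPart φ ν) μ := by
    filter_upwards [Ioo_mem_nhds hμ'.1 hμ'.2] with ν hν
    rw [← hμ.2]
    exact h.le_loss z (Ioo_subset_Icc_self hν)
  have hd : HasDerivAt (fun ν => -z * ν - realPart φ ν) (-z * 1 - deriv (realPart φ) μ) μ :=
    ((hasDerivAt_id μ).const_mul (-z)).sub (h.differentiableAt hμ').hasDerivAt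
  linarith [hmax.hasDerivAt_eq_zero hd]

theorem IsRegularPotential.isDual_neg_deriv (h : IsRegularPotential φ) {μ : ℝ}
    (hμ : μ ∈ Ioo (0 : ℝ) 1) : IsDual φ (-deriv (realPart φ) μ) μ := by
  have hμ' := Ioo_subset_Icc_self hμ
  refine h.isDual_of_forall_le hμ' fun ν hν => ?_
  have hconv := h.strictConvexOn_Icc.convexOn
  have hd := (h.differentiableAt hμ).hasDerivAt
  rcases lt_trichotomy ν μ with hlt | rfl | hlt
  · have := hconv.slope_le_of_hasDerivAt hν hμ' hlt hd
    rw [slope_def_field, div_le_iff₀ (by linarith)] at this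
    linarith
  · exact le_rfl
  · have := hconv.le_slope_of_hasDerivAt hμ' hν hlt hd
    rw [slope_def_field, le_div_iff₀ (by linarith)] at this
    linarith

/-- The loss as a function of its slope. -/
noncomputable def lossOfSlope (φ : ℝ → EReal) (μ : ℝ) : ℝ := μ * deriv (realPart φ) μ - realPart φ μ

theorem IsDual.lossOfSlope_eq (h : IsRegularPotential φ) {z μ : ℝ} (hμ : IsDual φ z μ)
    (hμ' : μ ∈ Ioo (0 : ℝ) 1) : lossOfSlope φ μ = loss φ z := by
  rw [lossOfSlope, hμ.deriv_eq h hμ', hμ.2]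
  ring

theorem IsRegularPotential.lossOfSlope_pos (h : IsRegularPotential φ) {μ : ℝ}
    (hμ : μ ∈ Ioo (0 : ℝ) 1) : 0 < lossOfSlope φ μ := by
  have hd := h.isDual_neg_deriv hμ
  rw [hd.lossOfSlope_eq h hμ]
  refine lt_of_le_of_ne (h.loss_nonneg _) fun h0 => hμ.1.ne ?_
  exact IsDual.unique h ⟨by simp, by simp [← h0, h.realPart_zero]⟩ hd

theorem IsRegularPotential.hasDerivAt_lossOfSlope (h : IsRegularPotential φ) {μ : ℝ}
    (hμ : μ ∈ Ioo (0 : ℝ) 1) :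
    HasDerivAt (lossOfSlope φ) (μ * deriv (deriv (realPart φ)) μ) μ := by
  have := ((hasDerivAt_id μ).mul (h.differentiableAt_deriv hμ).hasDerivAt).sub
    (h.differentiableAt hμ).hasDerivAt
  exact this.congr_deriv (by simp)

/-- `μ / h(μ) ^ α` is antitone as long as the local exponent stays below `α`. -/
theorem IsRegularPotential.div_lossOfSlope_rpow_le (h : IsRegularPotential φ) {α μ ν : ℝ}
    (hμ : 0 < μ) (hμν : μ ≤ ν) (hν : ν < 1)
    (hα : ∀ κ ∈ Icc μ ν, localExponent φ κ ≤ α) :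
    ν / lossOfSlope φ ν ^ α ≤ μ / lossOfSlope φ μ ^ α := by
  have hsub : ∀ κ ∈ Icc μ ν, κ ∈ Ioo (0 : ℝ) 1 := fun κ hκ =>
    ⟨hμ.trans_le hκ.1, hκ.2.trans_lt hν⟩
  have hder : ∀ κ ∈ Icc μ ν, HasDerivAt (fun κ => Real.log κ - α * Real.log (lossOfSlope φ κ))
      (κ⁻¹ - α * (κ * deriv (deriv (realPart φ)) κ / lossOfSlope φ κ)) κ := fun κ hκ =>
    (Real.hasDerivAt_log (hsub κ hκ).1.ne').sub
      (((h.hasDerivAt_lossOfSlope (hsub κ hκ)).log (h.lossOfSlope_pos (hsub κ hκ)).ne').const_mul α)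
  -- With `h = lossOfSlope φ` and `h' = κ φ''`, the derivative `1 / κ - α κ φ'' / h` is nonpositive
  -- exactly when `h / (κ ^ 2 φ'') ≤ α`, which is the bound on the local exponent.
  have hanti : AntitoneOn (fun κ => Real.log κ - α * Real.log (lossOfSlope φ κ)) (Icc μ ν) := by
    refine antitoneOn_of_deriv_nonpos (convex_Icc μ ν)
      (fun κ hκ => (hder κ hκ).continuousAt.continuousWithinAt)
      (fun κ hκ => (hder κ (interior_subset hκ)).differentiableAt.differentiableWithinAt)
      fun κ hκ => ?_
    have hκ' := interior_subset hκ
    have hκ01 := hsub κ hκ'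
    rw [(hder κ hκ').deriv]
    have h1 := hα κ hκ'
    have h2 := h.lossOfSlope_pos hκ01
    have h3 := h.deriv_deriv_pos κ hκ01
    have h4 := hκ01.1
    rw [localExponent, div_le_iff₀ (by positivity)] at h1
    rw [sub_nonpos, inv_eq_one_div, ← mul_div_assoc, div_le_div_iff₀ h4 h2]
    calc 1 * lossOfSlope φ κ ≤ α * (κ ^ 2 * deriv (deriv (realPart φ)) κ) := by
          rw [one_mul]; exact h1
      _ = _ := by ring
  have hμ' := hsub μ ⟨le_rfl, hμν⟩
  have hν' := hsub ν ⟨hμν, le_rfl⟩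
  have p1 := h.lossOfSlope_pos hμ'
  have p2 := h.lossOfSlope_pos hν'
  have hlog : ∀ κ ∈ Ioo (0 : ℝ) 1, Real.log (κ / lossOfSlope φ κ ^ α) =
      Real.log κ - α * Real.log (lossOfSlope φ κ) := fun κ hκ => by
    have := h.lossOfSlope_pos hκ
    rw [Real.log_div hκ.1.ne' (Real.rpow_pos_of_pos this _).ne', Real.log_rpow this]
  rw [← Real.log_le_log_iff (div_pos hν'.1 (Real.rpow_pos_of_pos p2 _))
    (div_pos hμ'.1 (Real.rpow_pos_of_pos p1 _)), hlog μ hμ', hlog ν hν']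
  exact hanti ⟨le_rfl, hμν⟩ ⟨hμν, le_rfl⟩ hμν

end Potential

/-! ### Lower bound for the slope in terms of the loss. -/

section Exponent

variable {φ : ℝ → EReal}

/-- If `0 < c ≤ ε̄`, then the slope of the loss is at least `C_φ c ^ α` wherever the loss is at
least `c`. -/
theorem IsRegularPotential.constC_mul_rpow_le (h : IsRegularPotential φ) {m epsBar α c z : ℝ}
    (hm : loss φ m = 0) (hα : IsExponent φ epsBar α) (hα_pos : 0 < α)
    (hC : 0 < constC φ epsBar α) (hc : 0 < c) (hc' : c ≤ epsBar) (hz : c ≤ loss φ z) :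
    constC φ epsBar α * c ^ α ≤ absSlope (loss φ) z := by
  obtain ⟨z₁, hz₁⟩ := h.exists_loss_eq hm (hc.le.trans hc')
  set zb := Function.invFun (loss φ) epsBar with hzb_def
  have hzb : loss φ zb = epsBar := Function.invFun_eq ⟨z₁, hz₁⟩
  have hdb := h.isDual_absSlope hm zb
  have hbar : muBar φ epsBar = absSlope (loss φ) zb := by
    rw [muBar, ← hzb_def, min_eq_left hdb.1.2]
  have hbar_pos : 0 < muBar φ epsBar := by
    rw [hbar]; exact h.absSlope_pos hm (by rw [hzb]; exact hc.trans_le hc')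
  have heb : 0 < epsBar := hc.trans_le hc'
  have hCeq : constC φ epsBar α = muBar φ epsBar / epsBar ^ α := by
    rw [constC]
    split_ifs with hlt
    · have hd : IsDual φ zb (muBar φ epsBar) := hbar ▸ hdb
      have := hd.lossOfSlope_eq h ⟨hbar_pos, hlt⟩
      rw [lossOfSlope, hzb] at this
      rw [this]
    · rfl
  -- Above `epsBar` the slope is at least `μ̄` by convexity. Below it, `μ ≤ μ̄`, and the
  -- monotonicity of `μ / h(μ) ^ α` compares `μ` with `μ̄`.
  rcases le_total epsBar (loss φ z) with hle | hle
  · have h1 : muBar φ epsBar ≤ absSlope (loss φ) z := by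
      rw [hbar]
      by_contra! hlt
      have hzz : zb < z := lt_of_not_ge fun hge => hlt.not_ge (h.antitone_absSlope hm hge)
      have := (h.isDual_absSlope hm z).loss_sub_le h zb
      rw [hzb] at this
      have hp := h.absSlope_pos hm (heb.trans_le hle)
      nlinarith
    refine le_trans ?_ h1
    rw [hCeq, div_mul_eq_mul_div, div_le_iff₀ (Real.rpow_pos_of_pos heb _)]
    gcongr
  · have hpos : 0 < loss φ z := hc.trans_le hz
    set μ := absSlope (loss φ) z with hμ_def
    have hμ : IsDual φ z μ := h.isDual_absSlope hm z
    have hμ_pos : 0 < μ := h.absSlope_pos hm hpos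
    have hpow : constC φ epsBar α * c ^ α ≤ constC φ epsBar α * loss φ z ^ α := by gcongr
    refine hpow.trans ?_
    rw [← le_div_iff₀ (Real.rpow_pos_of_pos hpos _), hCeq]
    have hμ_le : μ ≤ muBar φ epsBar := by
      rw [hbar]
      rcases le_total zb z with hzz | hzz
      · exact h.antitone_absSlope hm hzz
      · rcases eq_or_lt_of_le hzz with rfl | hlt
        · exact le_rfl
        have := (h.isDual_absSlope hm zb).loss_sub_le h z
        rw [hzb] at this
        have hp := hbar ▸ hbar_pos
        nlinarith
    rcases hμ.1.2.eq_or_lt with h1 | h1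
    · rw [h1] at hμ_le ⊢
      have : muBar φ epsBar = 1 := le_antisymm (min_le_right _ _) hμ_le
      rw [this]
      gcongr
    have hloss : ∀ ν, ν ∈ Ico μ 1 → ν ≤ muBar φ epsBar →
        ν / lossOfSlope φ ν ^ α ≤ μ / loss φ z ^ α := by
      intro ν hν hνb
      rw [← hμ.lossOfSlope_eq h ⟨hμ_pos, h1⟩]
      exact h.div_lossOfSlope_rpow_le hμ_pos hν.1 hν.2 fun κ hκ =>
        hα.1 ⟨κ, ⟨hμ_pos.trans_le hκ.1, hκ.2.trans hνb, hκ.2.trans_lt hν.2⟩, rfl⟩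
    rcases lt_or_ge (muBar φ epsBar) 1 with hlt | hge
    · have hd : IsDual φ zb (muBar φ epsBar) := hbar ▸ hdb
      have := hloss (muBar φ epsBar) ⟨hμ_le, hlt⟩ le_rfl
      rwa [hd.lossOfSlope_eq h ⟨hbar_pos, hlt⟩, hzb] at this
    · have hone : muBar φ epsBar = 1 := le_antisymm (min_le_right _ _) hge
      rw [hone]
      -- For `μ̄ = 1` the endpoint is out of reach of `φ'`, so the comparison is made at `ν < 1`,
      -- where `h(ν) ≤ epsBar`, followed by the limit `ν → 1`.
      have hν : ∀ ν ∈ Ioo μ 1, ν / epsBar ^ α ≤ μ / loss φ z ^ α := by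
        intro ν hν
        have hν01 : ν ∈ Ioo (0 : ℝ) 1 := ⟨hμ_pos.trans hν.1, hν.2⟩
        refine le_trans ?_ (hloss ν ⟨hν.1.le, hν.2⟩ (by rw [hone]; exact hν.2.le))
        have hd := h.isDual_neg_deriv hν01
        have hp := h.lossOfSlope_pos hν01
        have hle' : lossOfSlope φ ν ≤ epsBar := by
          rw [hd.lossOfSlope_eq h hν01, ← hzb]
          refine h.antitone_loss hm ?_
          by_contra! hlt
          have := hd.antitone h hdb hlt.le
          rw [← hbar, hone] at this
          linarith [hν.2]
        have := hν01.1
        gcongr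
      have hlim : Tendsto (fun ν : ℝ => ν / epsBar ^ α) (𝓝[<] 1) (𝓝 (1 / epsBar ^ α)) :=
        ((continuous_id.div_const _).tendsto 1).mono_left nhdsWithin_le_nhds
      refine le_of_tendsto hlim ?_
      filter_upwards [Ioo_mem_nhdsLT h1] with ν hν' using hν ν hν'

end Exponent

/-! ### The perceptron argument. -/

section Perceptron

variable {E : Type*} [NormedAddCommGroup E] [InnerProductSpace ℝ E]

/-- The perceptron argument: for updates `w ↦ w + η g v` along vectors `v` of norm at most `1` that
`wStar` separates with margin `γ`, where `g` vanishes on margins above `m`. -/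
theorem perceptron_bounds {w v : ℕ → E} {g : ℕ → ℝ} {wStar : E} {γ η m c : ℝ}
    (hw0 : w 0 = 0) (hw : ∀ t, w (t + 1) = w t + (η * g t) • v t) (hη : 0 < η) (hγ : 0 < γ)
    (hm : 0 ≤ m) (hstar : ‖wStar‖ = 1) (hv : ∀ t, ‖v t‖ ≤ 1) (hsep : ∀ t, γ ≤ inner ℝ wStar (v t))
    (hg0 : ∀ t, 0 ≤ g t) (hgc : ∀ t, g t ≤ c) (hgm : ∀ t, g t * inner ℝ (w t) (v t) ≤ g t * m)
    (t : ℕ) :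
    γ ^ 2 * (η * ∑ s ∈ Finset.range t, g s) ≤ 2 * m + η * c ∧ γ * ‖w t‖ ≤ 2 * m + η * c := by
  set G : ℕ → ℝ := fun t => ∑ s ∈ Finset.range t, g s with hG
  have hG0 : ∀ t, 0 ≤ G t := fun t => Finset.sum_nonneg fun s _ => hg0 s
  have hGs : ∀ t, G (t + 1) = G t + g t := fun t => Finset.sum_range_succ _ _
  have hc : 0 ≤ c := (hg0 0).trans (hgc 0)
  have hK : 0 ≤ 2 * m + η * c := by positivity
  have hlow : ∀ t, γ * (η * G t) ≤ inner ℝ wStar (w t) := by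
    intro t
    induction t with
    | zero => simp [hG, hw0]
    | succ t ih =>
      rw [hw, inner_add_right, inner_smul_right, hGs]
      have := mul_le_mul_of_nonneg_left (hsep t) (mul_nonneg hη.le (hg0 t))
      linarith
  have hup : ∀ t, ‖w t‖ ^ 2 ≤ η * G t * (2 * m + η * c) := by
    intro t
    induction t with
    | zero => simp [hG, hw0]
    | succ t ih =>
      rw [hw, norm_add_sq_real, inner_smul_right, norm_smul, hGs, Real.norm_of_nonneg
        (mul_nonneg hη.le (hg0 t))]
      have h1 : (η * g t * ‖v t‖) ^ 2 ≤ η * g t * (η * c) := by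
        calc (η * g t * ‖v t‖) ^ 2 ≤ (η * g t * 1) ^ 2 := by
              have := hg0 t
              gcongr
              exact hv t
          _ = η * g t * (η * g t) := by ring
          _ ≤ η * g t * (η * c) := by
              have := hg0 t
              gcongr
              exact hgc t
      have h2 := mul_le_mul_of_nonneg_left (hgm t) hη.le
      nlinarith
  have hle : γ * (η * G t) ≤ ‖w t‖ := by
    calc γ * (η * G t) ≤ inner ℝ wStar (w t) := hlow t
      _ ≤ ‖wStar‖ * ‖w t‖ := real_inner_le_norm _ _
      _ = ‖w t‖ := by rw [hstar, one_mul]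
  have hS : 0 ≤ η * G t := mul_nonneg hη.le (hG0 t)
  -- Cauchy–Schwarz bounds `(γ η G) ^ 2` by `‖w‖ ^ 2`, which is only linear in `η G`; one factor `η
  -- G` cancels.
  have hfirst : γ ^ 2 * (η * G t) ≤ 2 * m + η * c := by
    rcases hS.eq_or_lt with h0 | hpos
    · rw [← h0]; simpa using hK
    · have : (γ * (η * G t)) ^ 2 ≤ η * G t * (2 * m + η * c) :=
        (pow_le_pow_left₀ (by positivity) hle 2).trans (hup t)
      refine le_of_mul_le_mul_left ?_ hpos
      calc _ = (γ * (η * G t)) ^ 2 := by ring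
        _ ≤ _ := this
  refine ⟨hfirst, abs_le_of_sq_le_sq' ?_ hK |>.2⟩
  calc (γ * ‖w t‖) ^ 2 = γ ^ 2 * ‖w t‖ ^ 2 := by ring
    _ ≤ γ ^ 2 * (η * G t * (2 * m + η * c)) := by gcongr; exact hup t
    _ = γ ^ 2 * (η * G t) * (2 * m + η * c) := by ring
    _ ≤ (2 * m + η * c) * (2 * m + η * c) := by gcongr
    _ = _ := by ring

end Perceptron

/-! ### Binomial tails and blocks of trials. -/

section Binomial

/-- The probability of at least `j` successes in `n` independent trials with success
probability `p`. -/
def binomialTail (p : ℝ) : ℕ → ℕ → ℝ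
  | _, 0 => 1
  | 0, _ + 1 => 0
  | n + 1, j + 1 => p * binomialTail p n j + (1 - p) * binomialTail p n (j + 1)

variable {p : ℝ}

theorem binomialTail_zero_right (n : ℕ) : binomialTail p n 0 = 1 := by
  cases n <;> rfl

theorem binomialTail_mem_Icc (hp : p ∈ Icc (0 : ℝ) 1) (n j : ℕ) :
    binomialTail p n j ∈ Icc (0 : ℝ) 1 := by
  induction n generalizing j with
  | zero => cases j <;> simp [binomialTail]
  | succ n ih =>
    cases j with
    | zero => simp [binomialTail]
    | succ j =>
      have h1 := ih j
      have h2 := ih (j + 1)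
      exact (convex_Icc (0 : ℝ) 1) h1 h2 hp.1 (by linarith [hp.2]) (by ring)

theorem binomialTail_succ_right_le (hp : p ∈ Icc (0 : ℝ) 1) (n j : ℕ) :
    binomialTail p n (j + 1) ≤ binomialTail p n j := by
  induction n generalizing j with
  | zero => cases j <;> simp [binomialTail]
  | succ n ih =>
    cases j with
    | zero => exact (binomialTail_mem_Icc hp (n + 1) 1).2
    | succ j =>
      simp only [binomialTail]
      have := hp.1
      have : 0 ≤ 1 - p := by linarith [hp.2]
      gcongr
      · exact ih j
      · exact ih (j + 1)

theorem binomialTail_mono_left (hp : p ∈ Icc (0 : ℝ) 1) (j : ℕ) :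
    Monotone fun n => binomialTail p n j := by
  refine monotone_nat_of_le_succ fun n => ?_
  cases j with
  | zero => simp [binomialTail_zero_right]
  | succ j =>
    have := mul_le_mul_of_nonneg_left (binomialTail_succ_right_le hp n j) hp.1
    simp only [binomialTail]
    linarith

/-- Among `n + b` trials it suffices to have a success in a block of `b` and `j` successes in the
other `n`. -/
theorem mul_binomialTail_le (hp : p ∈ Icc (0 : ℝ) 1) (n j b : ℕ) :
    (1 - (1 - p) ^ b) * binomialTail p n j ≤ binomialTail p (n + b) (j + 1) := by
  induction b with
  | zero => simpa using (binomialTail_mem_Icc hp n (j + 1)).1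
  | succ b ih =>
    have h1 := mul_le_mul_of_nonneg_left
      (binomialTail_mono_left hp j (Nat.le_add_right n b)) hp.1
    have h2 := mul_le_mul_of_nonneg_left ih (by linarith [hp.2] : 0 ≤ 1 - p)
    rw [← add_assoc, binomialTail, pow_succ]
    simp only at h1
    nlinarith

/-- Splitting `T ≥ k b` trials into `k` blocks of length `b` with a success in each of them. -/
theorem pow_le_binomialTail (hp : p ∈ Icc (0 : ℝ) 1) {T k b : ℕ} (hT : k * b ≤ T) :
    (1 - (1 - p) ^ b) ^ k ≤ binomialTail p T k := by
  refine le_trans ?_ (binomialTail_mono_left hp k hT)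
  clear hT
  induction k with
  | zero => simp [binomialTail]
  | succ k ih =>
    have hq : 0 ≤ 1 - (1 - p) ^ b :=
      sub_nonneg.2 (pow_le_one₀ (by linarith [hp.2]) (by linarith [hp.1]))
    calc _ = (1 - (1 - p) ^ b) * (1 - (1 - p) ^ b) ^ k := by ring
      _ ≤ (1 - (1 - p) ^ b) * binomialTail p (k * b) k := by gcongr
      _ ≤ _ := by
        rw [Nat.succ_mul]
        exact mul_binomialTail_le hp _ _ _

/-- A block that is long enough contains a success with probability at least `√(1 - δ)`. -/
theorem one_sub_le_sq_one_sub_pow {δ : ℝ} (hp0 : 0 < p) (hp : p ≤ 1 / 2) (hδ : δ ∈ Ioo (0 : ℝ) 1)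
    {b : ℕ} (hb : 1 ≤ b) (hpb : 2 / p * Real.log (1 / δ) ≤ p * b) :
    1 - δ ≤ (1 - (1 - p) ^ b) ^ 2 := by
  obtain ⟨hδ0, hδ1⟩ := hδ
  set s := Real.log (1 / δ) with hs
  have hs0 : 0 < s := Real.log_pos (by rw [lt_div_iff₀ hδ0]; linarith)
  have hexp : Real.exp (-s) = δ := by
    rw [hs, one_div, Real.log_inv, neg_neg, Real.exp_log hδ0]
  have hb1 : (1 : ℝ) ≤ b := by exact_mod_cast hb
  have hpow : (1 - p) ^ b ≤ Real.exp (-(p * b)) := by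
    calc (1 - p) ^ b ≤ (Real.exp (-p)) ^ b :=
          pow_le_pow_left₀ (by linarith) (Real.one_sub_le_exp_neg p) b
      _ = _ := by rw [← Real.exp_nat_mul]; congr 1; ring
  -- Away from `δ = 1`, `p ≤ 1 / 2` gives `p b ≥ 4 s` and a failure probability of at most `δ ^ 4`.
  -- Near `δ = 1` that is too weak, and `b ≥ 1` is used instead: `(p b) ^ 2 ≥ p * (p b) ≥ 2 s`.
  rcases le_total δ (87 / 100) with hle | hle
  · have h4 : 4 * s ≤ p * b := by
      refine le_trans ?_ hpb
      gcongr
      rw [le_div_iff₀ hp0]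
      linarith
    have hq : (1 - p) ^ b ≤ δ ^ 4 := by
      refine hpow.trans ?_
      rw [← hexp, ← Real.exp_nat_mul]
      apply Real.exp_le_exp.2
      push_cast
      linarith
    have hδ4 : δ ^ 4 ≤ 1 := pow_le_one₀ hδ0.le hδ1.le
    have hsq : (1 - δ ^ 4) ^ 2 ≤ (1 - (1 - p) ^ b) ^ 2 :=
      pow_le_pow_left₀ (by linarith) (by linarith) 2
    have h3 : δ ^ 3 ≤ (87 / 100) ^ 3 := pow_le_pow_left₀ hδ0.le hle 3
    -- Equivalent to `1 - δ ≤ (1 - δ ^ 4) ^ 2`; it fails just below `δ = 1`, hence the threshold.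
    -- With `u = δ ^ 3` and `δ ≥ 3 / 4` it follows from `2 u ≤ 1 + 3 u ^ 2 / 4`, true for `u ≤ 2 /
    -- 3`.
    have h7 : 2 * δ ^ 3 ≤ 1 + δ ^ 7 := by
      have : δ ^ 7 = δ ^ 3 * δ ^ 3 * δ := by ring
      rcases le_total (δ ^ 3) (1 / 2) with hh | hh
      · have : 0 < δ ^ 7 := by positivity
        linarith
      · have hδlow : 3 / 4 ≤ δ := by
          by_contra! hlt
          have : δ ^ 3 ≤ (3 / 4) ^ 3 := pow_le_pow_left₀ hδ0.le hlt.le 3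
          norm_num at this
          linarith
        norm_num at h3
        nlinarith [mul_self_nonneg (δ ^ 3 - 0.65), mul_nonneg (mul_self_nonneg (δ ^ 3)) (sub_nonneg.2 hδlow)]
    nlinarith
  · set v := Real.sqrt (2 * s) with hv
    have hv0 : 0 ≤ v := Real.sqrt_nonneg _
    have hvsq : v ^ 2 = 2 * s := Real.sq_sqrt (by linarith)
    have hvle : v ≤ p * b := by
      refine Real.sqrt_le_iff.2 ⟨by positivity, ?_⟩
      have h1 : 2 / p * s * p ≤ p * b * (p * b) := by
        have : p ≤ p * b := le_mul_of_one_le_right hp0.le hb1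
        gcongr
      have h2 : 2 / p * s * p = 2 * s := by field_simp
      rw [sq]; linarith
    have hs_small : s ≤ 3 / 20 := by
      have : s ≤ 1 / δ - 1 := Real.log_le_sub_one_of_pos (by positivity)
      have h2 : 1 / δ ≤ 1 / (87 / 100) := by gcongr
      norm_num at h2
      norm_num at this
      linarith
    have hv_small : v ≤ 14 / 25 := by
      refine Real.sqrt_le_iff.2 ⟨by norm_num, by linarith⟩
    -- Uses `(1 + v + v ^ 2 / 2) * (1 - v + v ^ 2 / 2) = 1 + v ^ 4 / 4 ≥ 1`.
    have hq : (1 - p) ^ b ≤ 1 - v + v ^ 2 / 2 := by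
      refine (hpow.trans (Real.exp_le_exp.2 (neg_le_neg hvle))).trans ?_
      have h1 := Real.quadratic_le_exp_of_nonneg hv0
      rw [Real.exp_neg, inv_le_comm₀ (Real.exp_pos _) (by nlinarith)]
      refine le_trans ?_ h1
      rw [inv_le_iff_one_le_mul₀ (by nlinarith)]
      nlinarith [sq_nonneg (v ^ 2)]
    have h1 : 0 ≤ v - v ^ 2 / 2 := by nlinarith
    have hsq : (v - v ^ 2 / 2) ^ 2 ≤ (1 - (1 - p) ^ b) ^ 2 :=
      pow_le_pow_left₀ h1 (by linarith) 2
    have h2 : 1 - δ ≤ s := by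
      rw [← hexp]
      linarith [Real.one_sub_le_exp_neg s]
    have h3 : v ^ 2 / 2 ≤ (v - v ^ 2 / 2) ^ 2 := by
      have : (v - v ^ 2 / 2) ^ 2 - v ^ 2 / 2 = v ^ 2 * ((1 - v / 2) ^ 2 - 1 / 2) := by ring
      have h4 : 0 ≤ v ^ 2 * ((1 - v / 2) ^ 2 - 1 / 2) := by
        apply mul_nonneg (sq_nonneg v)
        nlinarith
      linarith
    linarith

/-- The chance of more than `N` successes in `T > N t` trials, where `t` is the block length for
losses bounded by `M` and success probability `p = ε / (2 M)`. -/
theorem rpow_le_binomialTail {δ N M ε : ℝ} (hδ : δ ∈ Ioo (0 : ℝ) 1) (hε : 0 < ε) (hM : ε ≤ M)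
    (hN : 1 ≤ N) {T : ℕ} (hT : N * blockLength M δ ε < T) :
    (1 - δ) ^ N ≤ binomialTail (ε / (2 * M)) T (⌊N⌋₊ + 1) := by
  have hM0 : 0 < M := hε.trans_le hM
  set p := ε / (2 * M) with hp_def
  have hp0 : 0 < p := by positivity
  have hp : p ≤ 1 / 2 := by rw [hp_def, div_le_div_iff₀ (by positivity) (by norm_num)]; linarith
  set k := ⌊N⌋₊ + 1 with hk
  have hkN : (k : ℝ) ≤ N + 1 := by
    rw [hk]; push_cast
    linarith [Nat.floor_le (zero_le_one.trans hN)]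
  have hk0 : (0 : ℝ) < k := by rw [hk]; positivity
  set t := blockLength M δ ε with ht
  have ht1 : 1 ≤ t := le_max_left _ _
  set s := Real.log (1 / δ) with hs
  have hs0 : 0 < s := Real.log_pos (by rw [lt_div_iff₀ hδ.1]; linarith [hδ.2])
  have hts : 8 * s / p ^ 2 ≤ t := by
    refine le_trans (le_of_eq ?_) ((le_max_left _ _).trans (le_max_right _ _))
    rw [hp_def]
    field_simp
    ring
  have hNT : N < T := lt_of_le_of_lt (le_mul_of_one_le_right (by linarith) ht1) hT
  have hkT : k ≤ T := Nat.succ_le_of_lt ((Nat.floor_lt (by linarith)).2 hNT)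
  set b := T / k with hb
  have hb1 : 1 ≤ b := Nat.div_pos hkT (Nat.succ_pos _)
  have hb1' : (1 : ℝ) ≤ b := by exact_mod_cast hb1
  have hTb : (T : ℝ) < k * (b + 1) := by
    have := Nat.lt_mul_div_succ T (Nat.succ_pos ⌊N⌋₊)
    exact_mod_cast this
  -- Rounding costs a factor `4`: `k ≤ N + 1 ≤ 2 N` and `b + 1 ≤ 2 b`.
  have hbt : t / 4 ≤ b := by
    have h1 : N * t < 2 * N * (b + 1) :=
      (hT.trans hTb).trans_le (by gcongr; linarith)
    have h2 : t < 2 * (b + 1) := by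
      by_contra! hge
      nlinarith
    linarith
  have hblock : 1 - δ ≤ (1 - (1 - p) ^ b) ^ 2 := by
    refine one_sub_le_sq_one_sub_pow hp0 hp hδ hb1 ?_
    calc 2 / p * s = p * (8 * s / p ^ 2 / 4) := by field_simp; ring
      _ ≤ p * b := by gcongr; linarith
  have hpI : p ∈ Icc (0 : ℝ) 1 := ⟨hp0.le, by linarith⟩
  refine le_trans ?_ (pow_le_binomialTail hpI (Nat.mul_div_le T k))
  rw [← hb]
  set q := 1 - (1 - p) ^ b with hq
  have hq1 : q ≤ 1 := by
    have : 0 ≤ (1 - p) ^ b := pow_nonneg (by linarith) _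
    linarith
  have hq0 : 0 < q := by
    have : (1 - p) ^ b < 1 := pow_lt_one₀ (by linarith) (by linarith) (by omega)
    linarith
  -- The square in `hblock` pays for having `k ≤ 2 N` blocks rather than `N`.
  calc (1 - δ) ^ N ≤ (q ^ 2) ^ N :=
        Real.rpow_le_rpow (by linarith [hδ.2]) hblock (by linarith)
    _ = q ^ (2 * N) := by rw [← Real.rpow_natCast, ← Real.rpow_mul hq0.le]; norm_num
    _ ≤ q ^ (k : ℝ) := Real.rpow_le_rpow_of_exponent_ge hq0 hq1 (by linarith)
    _ = q ^ k := Real.rpow_natCast _ _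

end Binomial

/-! ### Recursions driven by independent inputs. -/

section RandomIteration

variable {Ω S Ξ : Type*} [MeasurableSpace Ω] [MeasurableSpace S] [MeasurableSpace Ξ]
  {P : Measure Ω}

/-- A state that is computed recursively from independent inputs is independent of the next
input. -/
theorem indepFun_of_recursion {s : ℕ → Ω → S} {ξ : ℕ → Ω → Ξ} {Φ : ℕ → S × Ξ → S} {s₀ : S}
    (hΦ : ∀ t, Measurable (Φ t)) (hξ : ∀ t, Measurable (ξ t)) (hind : iIndepFun ξ P)
    (h0 : ∀ ω, s 0 ω = s₀) (hs : ∀ t ω, s (t + 1) ω = Φ t (s t ω, ξ t ω)) (t : ℕ) :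
    Measurable (s t) ∧ IndepFun (s t) (ξ t) P := by
  have hmeas : ∀ t, Measurable[⨆ i ∈ Iio t, MeasurableSpace.comap (ξ i) inferInstance] (s t) := by
    intro t
    induction t with
    | zero =>
      rw [show s 0 = fun _ => s₀ from funext h0]
      exact measurable_const
    | succ t ih =>
      rw [show s (t + 1) = fun ω => Φ t (s t ω, ξ t ω) from funext (hs t)]
      refine (hΦ t).comp (Measurable.prodMk (ih.mono ?_ le_rfl) ?_)
      · exact biSup_mono fun i hi => lt_trans hi (Nat.lt_succ_self t)
      · refine Measurable.mono (comap_measurable (ξ t)) ?_ le_rfl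
        exact le_biSup (fun i => MeasurableSpace.comap (ξ i) inferInstance) (Nat.lt_succ_self t)
  refine ⟨(hmeas t).mono (iSup₂_le fun i _ => (hξ i).comap_le) le_rfl, ?_⟩
  have hI : Indep (⨆ i ∈ Iio t, MeasurableSpace.comap (ξ i) inferInstance)
      (⨆ i ∈ ({t} : Set ℕ), MeasurableSpace.comap (ξ i) inferInstance) P :=
    indep_iSup_of_disjoint (fun i => (hξ i).comap_le) hind (by simp)
  rw [IndepFun_iff_Indep]
  refine indep_of_indep_of_le_left (indep_of_indep_of_le_right hI ?_) (hmeas t).comap_le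
  simp

theorem integrable_of_mem_Icc {ν : Measure Ω} [IsFiniteMeasure ν] {f : Ω → ℝ} (hf : Measurable f)
    (hb : ∀ ω, f ω ∈ Icc (0 : ℝ) 1) : Integrable f ν :=
  Integrable.of_bound hf.aestronglyMeasurable 1 <| ae_of_all _ fun ω => by
    rw [Real.norm_of_nonneg (hb ω).1]
    exact (hb ω).2

/-- Dynamic programming: if `V (n + 1)` lies below the expected value of `V n` after one step, then
`V n` lies below the expected value of `V 0` after `n` steps. -/
theorem integral_le_integral_of_step [IsProbabilityMeasure P] {s : ℕ → Ω → S} {ξ : ℕ → Ω → Ξ} {Φ : S × Ξ → S}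
    {V : ℕ → S → ℝ} (hΦ : Measurable Φ) (hV : ∀ n, Measurable (V n))
    (hVb : ∀ n x, V n x ∈ Icc (0 : ℝ) 1)
    (hξ : ∀ t, Measurable (ξ t)) (hid : ∀ t, IdentDistrib (ξ t) (ξ 0) P P)
    (hsm : ∀ t, Measurable (s t)) (hind : ∀ t, IndepFun (s t) (ξ t) P)
    (hs : ∀ t ω, s (t + 1) ω = Φ (s t ω, ξ t ω))
    (hstep : ∀ n x, V (n + 1) x ≤ ∫ z, V n (Φ (x, z)) ∂(P.map (ξ 0))) (n t : ℕ) :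
    ∫ ω, V n (s t ω) ∂P ≤ ∫ ω, V 0 (s (t + n) ω) ∂P := by
  induction n generalizing t with
  | zero => exact le_rfl
  | succ n ih =>
    rw [← add_assoc, add_right_comm]
    refine le_trans ?_ (ih (t + 1))
    have : IsProbabilityMeasure (P.map (ξ 0)) := Measure.isProbabilityMeasure_map (hξ 0).aemeasurable
    have : IsProbabilityMeasure (P.map (s t)) := Measure.isProbabilityMeasure_map (hsm t).aemeasurable
    -- Independence makes the joint law a product, so Fubini turns the pointwise bound `hstep` into
    -- one for expectations.
    have hprod : P.map (fun ω => (s t ω, ξ t ω)) = (P.map (s t)).prod (P.map (ξ 0)) := by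
      rw [(indepFun_iff_map_prod_eq_prod_map_map (hsm t).aemeasurable (hξ t).aemeasurable).1
        (hind t), (hid t).map_eq]
    have hint : Integrable (fun q => V n (Φ q)) ((P.map (s t)).prod (P.map (ξ 0))) :=
      integrable_of_mem_Icc ((hV n).comp hΦ) fun q => hVb n (Φ q)
    calc ∫ ω, V (n + 1) (s t ω) ∂P = ∫ x, V (n + 1) x ∂(P.map (s t)) :=
          (integral_map (hsm t).aemeasurable (hV _).aestronglyMeasurable).symm
      _ ≤ ∫ x, ∫ z, V n (Φ (x, z)) ∂(P.map (ξ 0)) ∂(P.map (s t)) :=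
          integral_mono (integrable_of_mem_Icc (hV _) (hVb _)) hint.integral_prod_left
            fun x => hstep n x
      _ = ∫ q, V n (Φ q) ∂((P.map (s t)).prod (P.map (ξ 0))) :=
          (integral_prod _ hint).symm
      _ = ∫ ω, V n (s (t + 1) ω) ∂P := by
          rw [← hprod, integral_map (f := fun q => V n (Φ q)) ((hsm t).prodMk (hξ t)).aemeasurable
            ((hV n).comp hΦ).aestronglyMeasurable]
          simp only [hs]

end RandomIteration

/-! ### One SGD step and the counter of large losses. -/

section StochasticGradient

variable {φ : ℝ → EReal} {d : ℕ}

theorem IsRegularPotential.gradient_sampleLoss (h : IsRegularPotential φ) {m : ℝ}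
    (hm : loss φ m = 0) (x : EuclideanSpace ℝ (Fin d)) (y : ℝ) (w : EuclideanSpace ℝ (Fin d)) :
    gradient (sampleLoss (loss φ) x y) w =
      -(absSlope (loss φ) (inner ℝ w (y • x)) • (y • x)) := by
  apply HasGradientAt.gradient
  rw [hasGradientAt_iff_hasFDerivAt]
  have h1 : HasFDerivAt (fun w : EuclideanSpace ℝ (Fin d) => (inner ℝ w (y • x) : ℝ))
      (innerSL ℝ (y • x)) w :=
    (innerSL ℝ (y • x)).hasFDerivAt.congr_of_eventuallyEq
      (.of_forall fun w => real_inner_comm _ _)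
  have h2 := (h.hasDerivAt_loss hm (inner ℝ w (y • x))).comp_hasFDerivAt w h1
  refine h2.congr_fderiv ?_
  ext v
  simp

/-- The population risk, as a function of the law of a sample. -/
noncomputable def populationRisk (ν : Measure (EuclideanSpace ℝ (Fin d) × ℝ)) (ℓ : ℝ → ℝ)
    (w : EuclideanSpace ℝ (Fin d)) : ℝ :=
  ∫ z, sampleLoss ℓ z.1 z.2 w ∂ν

/-- The update of SGD together with a counter that counts the samples with loss at least `c`, and
that is set to `k` as soon as the population risk is at most `ε` or the norm exceeds `B`. -/
noncomputable def sgdStep (ν : Measure (EuclideanSpace ℝ (Fin d) × ℝ)) (ℓ : ℝ → ℝ)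
    (η ε B c : ℝ) (k : ℕ)
    (q : (EuclideanSpace ℝ (Fin d) × ℕ) × (EuclideanSpace ℝ (Fin d) × ℝ)) :
    EuclideanSpace ℝ (Fin d) × ℕ :=
  open Classical in
  (q.1.1 + (η * absSlope ℓ (inner ℝ q.1.1 (q.2.2 • q.2.1))) • (q.2.2 • q.2.1),
    if populationRisk ν ℓ q.1.1 ≤ ε ∨ B < ‖q.1.1‖ then k
    else if c ≤ sampleLoss ℓ q.2.1 q.2.2 q.1.1 then q.1.2 + 1 else q.1.2)

theorem measurable_sampleLoss {ℓ : ℝ → ℝ} (hℓ : Continuous ℓ) :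
    Measurable fun q : EuclideanSpace ℝ (Fin d) × (EuclideanSpace ℝ (Fin d) × ℝ) =>
      sampleLoss ℓ q.2.1 q.2.2 q.1 := by
  unfold sampleLoss
  exact (hℓ.comp (by fun_prop)).measurable

theorem measurable_sampleLoss_right {ℓ : ℝ → ℝ} (hℓ : Continuous ℓ)
    (w : EuclideanSpace ℝ (Fin d)) :
    Measurable fun z : EuclideanSpace ℝ (Fin d) × ℝ => sampleLoss ℓ z.1 z.2 w :=
  (measurable_sampleLoss hℓ).comp measurable_prodMk_left

theorem measurable_populationRisk {ν : Measure (EuclideanSpace ℝ (Fin d) × ℝ)} [SFinite ν]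
    {ℓ : ℝ → ℝ} (hℓ : Continuous ℓ) : Measurable (populationRisk ν ℓ) :=
  ((measurable_sampleLoss hℓ).stronglyMeasurable.integral_prod_right (ν := ν)).measurable

theorem measurable_sgdStep {ν : Measure (EuclideanSpace ℝ (Fin d) × ℝ)} [SFinite ν]
    {ℓ : ℝ → ℝ} (hℓ : Continuous ℓ) (η ε B c : ℝ) (k : ℕ) :
    Measurable (sgdStep ν ℓ η ε B c k) := by
  have hg : Measurable (absSlope ℓ) := (measurable_deriv ℓ).abs
  have hw : Measurable fun q : (EuclideanSpace ℝ (Fin d) × ℕ) × (EuclideanSpace ℝ (Fin d) × ℝ) =>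
      q.1.1 := by fun_prop
  have hv : Measurable fun q : (EuclideanSpace ℝ (Fin d) × ℕ) × (EuclideanSpace ℝ (Fin d) × ℝ) =>
      q.2.2 • q.2.1 := by fun_prop
  have hc : Measurable fun q : (EuclideanSpace ℝ (Fin d) × ℕ) × (EuclideanSpace ℝ (Fin d) × ℝ) =>
      q.1.2 := by fun_prop
  refine Measurable.prodMk ?_ (Measurable.ite ?_ measurable_const (Measurable.ite ?_ ?_ hc))
  · exact hw.add (((hg.comp (hw.inner hv)).const_mul η).smul hv)
  · exact (measurableSet_le ((measurable_populationRisk hℓ).comp hw)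
      measurable_const).union (measurableSet_lt measurable_const hw.norm)
  · exact measurableSet_le measurable_const ((measurable_sampleLoss hℓ).comp
      (hw.prodMk measurable_snd))
  · exact (measurable_of_countable fun c : ℕ => c + 1).comp hc

/-- A sample has loss at least `ε / 2` with probability at least `ε / (2 M)` if the risk exceeds `ε`
and the losses are bounded by `M`. -/
theorem le_measureReal_of_lt_integral {X : Type*} [MeasurableSpace X] {ν : Measure X}
    [IsProbabilityMeasure ν] {f : X → ℝ} (hf : Measurable f) (hf0 : ∀ x, 0 ≤ f x) {ε M : ℝ}
    (hM0 : 0 < M) (hM : ∀ᵐ x ∂ν, f x ≤ M) (hε0 : 0 ≤ ε) (hε : ε < ∫ x, f x ∂ν) :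
    ε / (2 * M) ≤ ν.real {x | ε / 2 ≤ f x} := by
  have hS : MeasurableSet {x | ε / 2 ≤ f x} := measurableSet_le measurable_const hf
  have hint : Integrable ({x | ε / 2 ≤ f x}.indicator fun _ => M) ν :=
    (integrable_const M).indicator hS
  -- A reverse Markov inequality: almost everywhere `f` is at most `ε / 2`, plus `M` where it is
  -- large.
  have hle : ∫ x, f x ∂ν ≤ ∫ x, (ε / 2 + {x | ε / 2 ≤ f x}.indicator (fun _ => M) x) ∂ν := by
    refine integral_mono_of_nonneg (ae_of_all _ hf0) ((integrable_const _).add hint) ?_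
    filter_upwards [hM] with x hx
    by_cases h : ε / 2 ≤ f x
    · rw [indicator_of_mem (by exact h)]
      linarith
    · rw [indicator_of_notMem (by exact h)]
      linarith
  rw [integral_add (integrable_const _) hint, integral_indicator_const _ hS] at hle
  simp only [integral_const, probReal_univ, smul_eq_mul, one_mul] at hle
  rw [div_le_iff₀ (by positivity)]
  linarith

/-- One step of the counter process does not decrease the binomial tail that remains. -/
theorem binomialTail_le_integral_sgdStep {ν : Measure (EuclideanSpace ℝ (Fin d) × ℝ)}
    [IsProbabilityMeasure ν] {ℓ : ℝ → ℝ} (hℓ : Continuous ℓ) (hℓ0 : ∀ z, 0 ≤ ℓ z)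
    {η ε B M : ℝ} {k : ℕ} (hε : 0 < ε) (hM : ε ≤ M)
    (hB : ∀ w : EuclideanSpace ℝ (Fin d), ‖w‖ ≤ B → ∀ᵐ z ∂ν, sampleLoss ℓ z.1 z.2 w ≤ M)
    (n : ℕ) (s : EuclideanSpace ℝ (Fin d) × ℕ) :
    binomialTail (ε / (2 * M)) (n + 1) (k - s.2) ≤
      ∫ z, binomialTail (ε / (2 * M)) n (k - (sgdStep ν ℓ η ε B (ε / 2) k (s, z)).2) ∂ν := by
  classical
  obtain ⟨w, c⟩ := s
  have hM0 : 0 < M := hε.trans_le hM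
  set p := ε / (2 * M) with hp_def
  have hp : p ∈ Icc (0 : ℝ) 1 :=
    ⟨by positivity, by rw [hp_def, div_le_one (by positivity)]; linarith⟩
  by_cases h_risk : populationRisk ν ℓ w ≤ ε ∨ B < ‖w‖
  · simpa [sgdStep, h_risk, binomialTail_zero_right] using (binomialTail_mem_Icc hp _ _).2
  -- After stopping nothing remains to be counted and the tail is `1`; the same holds if the counter
  -- has already reached `k`. Otherwise a success has probability at least `p`, and the tail can
  -- only gain from that, being antitone in the number of missing successes.
  rcases hj : k - c with _ | j
  · have : ∀ z, k - (sgdStep ν ℓ η ε B (ε / 2) k ((w, c), z)).2 = 0 := by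
      intro z
      simp only [sgdStep, if_neg h_risk]
      split_ifs <;> omega
    simp [this, binomialTail_zero_right]
  push Not at h_risk
  set A : Set (EuclideanSpace ℝ (Fin d) × ℝ) := {z | ε / 2 ≤ sampleLoss ℓ z.1 z.2 w} with hA_def
  have hmeas := measurable_sampleLoss_right hℓ w
  have hA : MeasurableSet A := measurableSet_le measurable_const hmeas
  have hpA : p ≤ ν.real A :=
    le_measureReal_of_lt_integral hmeas (fun z => hℓ0 _) hM0 (hB w h_risk.2) hε.le h_risk.1
  have hV : ∀ z, binomialTail p n (k - (sgdStep ν ℓ η ε B (ε / 2) k ((w, c), z)).2) =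
      binomialTail p n (j + 1) +
        A.indicator (fun _ => binomialTail p n j - binomialTail p n (j + 1)) z := by
    intro z
    have hns : ¬(populationRisk ν ℓ w ≤ ε ∨ B < ‖w‖) := by push Not; exact h_risk
    simp only [sgdStep, if_neg hns]
    by_cases hz : ε / 2 ≤ sampleLoss ℓ z.1 z.2 w
    · rw [if_pos hz, indicator_of_mem (by exact hz), show k - (c + 1) = j by omega]
      ring
    · rw [if_neg hz, indicator_of_notMem (by exact hz), hj, add_zero]
  simp only [hV]
  rw [integral_add (integrable_const _) ((integrable_const _).indicator hA),
    integral_indicator_const _ hA]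
  simp only [integral_const, probReal_univ, smul_eq_mul, one_mul, binomialTail]
  nlinarith [mul_le_mul_of_nonneg_right hpA (sub_nonneg.2 (binomialTail_succ_right_le hp n j))]

end StochasticGradient

/-! ### Assembling the bounds for SGD on separable data. -/

section Main

variable {φ : ℝ → EReal} {d : ℕ}

theorem blockCount_eq {α C γ m η Cg ε : ℝ} (hε : 0 < ε) :
    blockCount α C γ m η Cg ε = (4 * m / η + Cg) / (γ ^ 2 * (C * (ε / 2) ^ α)) := by
  rw [blockCount, Real.rpow_neg hε.le, Real.div_rpow hε.le zero_le_two]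
  have := Real.rpow_pos_of_pos hε α
  have := Real.rpow_pos_of_pos (zero_lt_two (α := ℝ)) α
  field_simp

theorem IsRegularPotential.sgd_succ (h : IsRegularPotential φ) {m : ℝ} (hm : loss φ m = 0) (η : ℝ)
    (x : ℕ → EuclideanSpace ℝ (Fin d)) (y : ℕ → ℝ) (t : ℕ) :
    sgd (loss φ) η x y (t + 1) = sgd (loss φ) η x y t +
      (η * absSlope (loss φ) (inner ℝ (sgd (loss φ) η x y t) (y t • x t))) • (y t • x t) := by
  rw [sgd, h.gradient_sampleLoss hm, smul_neg, sub_neg_eq_add, smul_smul η]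

theorem norm_label_smul_le {x : EuclideanSpace ℝ (Fin d)} {y : ℝ} (hx : ‖x‖ ≤ 1)
    (hy : y = 1 ∨ y = -1) : ‖y • x‖ ≤ 1 := by
  rcases hy with rfl | rfl <;> simpa using hx

/-- The perceptron bounds for SGD on separable data. -/
theorem LossAssumption.sgd_bounds {Cg : ℝ} (hloss : LossAssumption φ Cg) {m : ℝ}
    (hm : IsSeparationMargin (loss φ) m) {η γ : ℝ} (hη : 0 < η) (hγ : 0 < γ)
    {wStar : EuclideanSpace ℝ (Fin d)} (hstar : ‖wStar‖ = 1)
    {x : ℕ → EuclideanSpace ℝ (Fin d)} {y : ℕ → ℝ} (hx : ∀ t, ‖x t‖ ≤ 1)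
    (hy : ∀ t, y t = 1 ∨ y t = -1) (hsep : ∀ t, γ ≤ inner ℝ wStar (y t • x t)) (t : ℕ) :
    γ ^ 2 * (η * ∑ s ∈ Finset.range t,
        absSlope (loss φ) (inner ℝ (sgd (loss φ) η x y s) (y s • x s))) ≤ 4 * m + η * Cg ∧
      ‖sgd (loss φ) η x y t‖ ≤ (4 * m + η * Cg) / γ := by
  have h := hloss.potential
  have hm0 := hm.1.2 m le_rfl
  have hmp := hm.1.1
  have hgm : ∀ t, absSlope (loss φ) (inner ℝ (sgd (loss φ) η x y t) (y t • x t)) *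
      inner ℝ (sgd (loss φ) η x y t) (y t • x t) ≤
        absSlope (loss φ) (inner ℝ (sgd (loss φ) η x y t) (y t • x t)) * m := by
    intro t
    rcases le_total (inner ℝ (sgd (loss φ) η x y t) (y t • x t)) m with hle | hle
    · exact mul_le_mul_of_nonneg_left hle (abs_nonneg _)
    · rw [h.absSlope_eq_zero (hm.1.2 _ hle), zero_mul, zero_mul]
  obtain ⟨h1, h2⟩ := perceptron_bounds (c := Cg) rfl (h.sgd_succ hm0 η x y) hη hγ hmp.le hstar
    (fun t => norm_label_smul_le (hx t) (hy t)) hsep (fun t => abs_nonneg _)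
    (fun t => hloss.lipschitz _) hgm t
  refine ⟨h1.trans (by linarith), ?_⟩
  rw [le_div_iff₀ hγ]
  linarith

theorem IsRegularPotential.sampleLoss_le (h : IsRegularPotential φ) {m : ℝ} (hm : loss φ m = 0)
    {x w : EuclideanSpace ℝ (Fin d)} {y B : ℝ} (hx : ‖x‖ ≤ 1) (hy : y = 1 ∨ y = -1)
    (hw : ‖w‖ ≤ B) : sampleLoss (loss φ) x y w ≤ loss φ (-B) := by
  refine h.antitone_loss hm ?_
  have h1 : |inner ℝ w (y • x)| ≤ ‖w‖ * ‖y • x‖ := abs_real_inner_le_norm _ _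
  have h2 : ‖w‖ * ‖y • x‖ ≤ ‖w‖ :=
    mul_le_of_le_one_right (norm_nonneg _) (norm_label_smul_le hx hy)
  linarith [neg_abs_le (inner ℝ w (y • x))]

variable {Ω : Type*} [MeasurableSpace Ω] {P : Measure Ω}
  {x : ℕ → Ω → EuclideanSpace ℝ (Fin d)} {y : ℕ → Ω → ℝ} {wStar : EuclideanSpace ℝ (Fin d)} {γ : ℝ}

theorem DataAssumption.ae_good (hdata : DataAssumption P x y wStar γ) : ∀ᵐ ω ∂P,
    (∀ t, ‖x t ω‖ ≤ 1) ∧ (∀ t, y t ω = 1 ∨ y t ω = -1) ∧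
      ∀ t, γ ≤ inner ℝ wStar (y t ω • x t ω) := by
  filter_upwards [ae_all_iff.2 hdata.norm_le_one, ae_all_iff.2 hdata.label,
    ae_all_iff.2 hdata.separable] with ω h1 h2 h3 using ⟨h1, h2, h3⟩

theorem DataAssumption.margin_le_one [IsProbabilityMeasure P]
    (hdata : DataAssumption P x y wStar γ) : γ ≤ 1 := by
  obtain ⟨ω, h1, h2, h3⟩ := hdata.ae_good.exists
  calc γ ≤ inner ℝ wStar (y 0 ω • x 0 ω) := h3 0
    _ ≤ ‖wStar‖ * ‖y 0 ω • x 0 ω‖ := real_inner_le_norm _ _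
    _ ≤ 1 := by rw [hdata.norm_wStar, one_mul]; exact norm_label_smul_le (h1 0) (h2 0)

theorem DataAssumption.measurable_sample (hdata : DataAssumption P x y wStar γ) (t : ℕ) :
    Measurable fun ω => (x t ω, y t ω) :=
  (hdata.measurable_x t).prodMk (hdata.measurable_y t)

theorem DataAssumption.expectedLoss_eq (hdata : DataAssumption P x y wStar γ) {ℓ : ℝ → ℝ}
    (hℓ : Continuous ℓ) (t : ℕ) (w : EuclideanSpace ℝ (Fin d)) :
    expectedLoss P ℓ x y t w = populationRisk (P.map fun ω => (x 0 ω, y 0 ω)) ℓ w := by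
  rw [populationRisk, ← (hdata.identDistrib t).map_eq,
    integral_map (hdata.measurable_sample t).aemeasurable
      (measurable_sampleLoss_right hℓ w).aestronglyMeasurable]
  rfl

theorem DataAssumption.ae_sampleLoss_le (hdata : DataAssumption P x y wStar γ)
    (h : IsRegularPotential φ) {m : ℝ} (hm : loss φ m = 0) {B : ℝ}
    {w : EuclideanSpace ℝ (Fin d)} (hw : ‖w‖ ≤ B) :
    ∀ᵐ z ∂(P.map fun ω => (x 0 ω, y 0 ω)), sampleLoss (loss φ) z.1 z.2 w ≤ loss φ (-B) := by
  rw [ae_map_iff (hdata.measurable_sample 0).aemeasurable (measurableSet_le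
    (measurable_sampleLoss_right (h.continuous_loss hm) w) measurable_const)]
  filter_upwards [hdata.ae_good] with ω ⟨h1, h2, _⟩ using h.sampleLoss_le hm (h1 0) (h2 0) hw

/-- The SGD iterate together with the counter of `sgdStep`, which starts at time `1`. -/
noncomputable def sgdState (ν : Measure (EuclideanSpace ℝ (Fin d) × ℝ)) (ℓ : ℝ → ℝ)
    (η ε B : ℝ) (k : ℕ) (x : ℕ → EuclideanSpace ℝ (Fin d)) (y : ℕ → ℝ) :
    ℕ → EuclideanSpace ℝ (Fin d) × ℕ
  | 0 => (0, 0)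
  | t + 1 =>
    ((sgdStep ν ℓ η ε B (ε / 2) k (sgdState ν ℓ η ε B k x y t, (x t, y t))).1,
      if t = 0 then 0
      else (sgdStep ν ℓ η ε B (ε / 2) k (sgdState ν ℓ η ε B k x y t, (x t, y t))).2)

theorem sgdState_succ_succ (ν : Measure (EuclideanSpace ℝ (Fin d) × ℝ)) (ℓ : ℝ → ℝ)
    (η ε B : ℝ) (k : ℕ) (x : ℕ → EuclideanSpace ℝ (Fin d)) (y : ℕ → ℝ) (t : ℕ) :
    sgdState ν ℓ η ε B k x y (t + 1 + 1) =
      sgdStep ν ℓ η ε B (ε / 2) k (sgdState ν ℓ η ε B k x y (t + 1), (x (t + 1), y (t + 1))) := by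
  rw [sgdState, if_neg (Nat.succ_ne_zero t)]

theorem IsRegularPotential.sgdState_fst (h : IsRegularPotential φ) {m : ℝ} (hm : loss φ m = 0)
    (ν : Measure (EuclideanSpace ℝ (Fin d) × ℝ)) (η ε B : ℝ) (k : ℕ)
    (x : ℕ → EuclideanSpace ℝ (Fin d)) (y : ℕ → ℝ) (t : ℕ) :
    (sgdState ν (loss φ) η ε B k x y t).1 = sgd (loss φ) η x y t := by
  induction t with
  | zero => rfl
  | succ t ih =>
    rw [h.sgd_succ hm, sgdState, ← ih]
    rfl

/-- As long as the process has not been stopped, the counter times a lower bound `a` for the slope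
of the counted losses is at most the sum of all slopes. -/
theorem IsRegularPotential.sgdState_snd_mul_le (h : IsRegularPotential φ) {m : ℝ}
    (hm : loss φ m = 0) {ν : Measure (EuclideanSpace ℝ (Fin d) × ℝ)} {η ε B a : ℝ} {k : ℕ}
    {x : ℕ → EuclideanSpace ℝ (Fin d)} {y : ℕ → ℝ} {T : ℕ}
    (ha : ∀ z, ε / 2 ≤ loss φ z → a ≤ absSlope (loss φ) z)
    (hB : ∀ t, ‖sgd (loss φ) η x y t‖ ≤ B)
    (hT : ∀ t ∈ Finset.Icc 1 T, ε < populationRisk ν (loss φ) (sgd (loss φ) η x y t)) :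
    ((sgdState ν (loss φ) η ε B k x y (T + 1)).2 : ℝ) * a ≤ ∑ s ∈ Finset.range (T + 1),
      absSlope (loss φ) (inner ℝ (sgd (loss φ) η x y s) (y s • x s)) := by
  induction T with
  | zero => simp [sgdState, absSlope]
  | succ T ih =>
    have hT1 := hT (T + 1) (by simp)
    have ih := ih fun t ht => hT t (Finset.Icc_subset_Icc_right (Nat.le_succ T) ht)
    have hns : ¬(populationRisk ν (loss φ) (sgd (loss φ) η x y (T + 1)) ≤ ε ∨
        B < ‖sgd (loss φ) η x y (T + 1)‖) := by
      push Not
      exact ⟨hT1, hB _⟩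
    rw [Finset.sum_range_succ, sgdState, if_neg (Nat.succ_ne_zero T), sgdStep]
    simp only [h.sgdState_fst hm]
    rw [if_neg hns]
    split_ifs with hc
    · push_cast
      linarith [ha _ hc]
    · exact ih.trans (le_add_of_nonneg_right (abs_nonneg _))

/-- The counter reaches `k` within `T` counted steps at least as often as independent trials with
success probability `ε / (2 M)`. -/
theorem DataAssumption.binomialTail_le [IsProbabilityMeasure P]
    (hdata : DataAssumption P x y wStar γ) (h : IsRegularPotential φ) {m : ℝ} (hm : loss φ m = 0)
    {η ε B : ℝ} (hε : 0 < ε) (hM : ε ≤ loss φ (-B)) (k T : ℕ) :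
    binomialTail (ε / (2 * loss φ (-B))) T k ≤ P.real {ω | k ≤ (sgdState
      (P.map fun ω => (x 0 ω, y 0 ω)) (loss φ) η ε B k (fun s => x s ω) (fun s => y s ω)
        (T + 1)).2} := by
  have hℓ := h.continuous_loss hm
  have hprob : IsProbabilityMeasure (P.map fun ω => (x 0 ω, y 0 ω)) :=
    Measure.isProbabilityMeasure_map (hdata.measurable_sample 0).aemeasurable
  set ν := P.map fun ω => (x 0 ω, y 0 ω)
  set M := loss φ (-B)
  have hp : ε / (2 * M) ∈ Icc (0 : ℝ) 1 :=
    ⟨by have := hε.trans_le hM; positivity,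
      by rw [div_le_one (by linarith)]; linarith⟩
  set s : ℕ → Ω → EuclideanSpace ℝ (Fin d) × ℕ := fun t ω =>
    sgdState ν (loss φ) η ε B k (fun s => x s ω) (fun s => y s ω) t
  set F := sgdStep ν (loss φ) η ε B (ε / 2) k
  have hFm : Measurable F := measurable_sgdStep hℓ η ε B (ε / 2) k
  have hs := indepFun_of_recursion (P := P) (s := s) (s₀ := (0, 0))
    (ξ := fun t ω => (x t ω, y t ω))
    (Φ := fun t q => ((F q).1, if t = 0 then 0 else (F q).2))
    (fun t => hFm.fst.prodMk (by split_ifs <;> fun_prop)) hdata.measurable_sample hdata.indep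
    (fun ω => rfl) (fun t ω => rfl)
  have hVm : ∀ n, Measurable fun q : EuclideanSpace ℝ (Fin d) × ℕ =>
      binomialTail (ε / (2 * M)) n (k - q.2) := fun n =>
    (measurable_of_countable fun c : ℕ => binomialTail (ε / (2 * M)) n (k - c)).comp measurable_snd
  have hid : ∀ t, P.map (fun ω => (x t ω, y t ω)) = ν := fun t => (hdata.identDistrib t).map_eq
  -- Time is shifted by one: the update at time `0` leaves the counter at `0`, because the minimum
  -- in question runs over `t ≥ 1`.
  have key := integral_le_integral_of_step (P := P) (s := fun t => s (t + 1))
    (ξ := fun t ω => (x (t + 1) ω, y (t + 1) ω)) (Φ := F)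
    (V := fun n q => binomialTail (ε / (2 * M)) n (k - q.2)) hFm hVm
    (fun n q => binomialTail_mem_Icc hp _ _) (fun t => hdata.measurable_sample (t + 1))
    (fun t => (hdata.identDistrib (t + 1)).trans (hdata.identDistrib (0 + 1)).symm)
    (fun t => (hs (t + 1)).1) (fun t => (hs (t + 1)).2)
    (fun t ω => sgdState_succ_succ _ _ _ _ _ _ _ _ t)
    (fun n q => by
      rw [hid]
      exact binomialTail_le_integral_sgdStep hℓ h.loss_nonneg hε hM
        (fun w hw => hdata.ae_sampleLoss_le h hm hw) n q) T 0
  have hset : MeasurableSet {ω | k ≤ (s (T + 1) ω).2} :=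
    measurableSet_le measurable_const (hs (T + 1)).1.snd
  have hleft : ∀ ω, (s (0 + 1) ω).2 = 0 := fun ω => rfl
  have hright : ∀ ω, binomialTail (ε / (2 * M)) 0 (k - (s (0 + T + 1) ω).2) =
      {ω | k ≤ (s (T + 1) ω).2}.indicator (fun _ => (1 : ℝ)) ω := by
    intro ω
    rw [zero_add]
    by_cases hk : k ≤ (s (T + 1) ω).2
    · rw [indicator_of_mem (by exact hk), Nat.sub_eq_zero_of_le hk, binomialTail_zero_right]
    · rw [indicator_of_notMem (by exact hk)]
      obtain ⟨j, hj⟩ := Nat.exists_eq_succ_of_ne_zero (Nat.sub_ne_zero_of_lt (not_le.1 hk))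
      rw [hj, binomialTail]
  simp only [hleft, hright, integral_indicator_const _ hset, integral_const, probReal_univ,
    smul_eq_mul, one_mul, mul_one, Nat.sub_zero] at key
  exact key

end Main

end FenchelYoung

theorem mainTheorem5 {Ω : Type*} [MeasurableSpace Ω] (P : Measure Ω) [IsProbabilityMeasure P]
    {d : ℕ} (x : ℕ → Ω → EuclideanSpace ℝ (Fin d)) (y : ℕ → Ω → ℝ)
    (wStar : EuclideanSpace ℝ (Fin d)) (γ : ℝ)
    (hdata : FenchelYoung.DataAssumption P x y wStar γ)
    (φ : ℝ → EReal) (Cg : ℝ) (hloss : FenchelYoung.LossAssumption φ Cg)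
    (m : ℝ) (hm : FenchelYoung.IsSeparationMargin (FenchelYoung.loss φ) m)
    (η : ℝ) (hη : 0 < η)
    (δ : ℝ) (hδ : δ ∈ Set.Ioo (0 : ℝ) 1)
    (epsBar : ℝ) (hepsBar : epsBar ∈ Set.Ioo (0 : ℝ) 1)
    (α : ℝ) (hα : FenchelYoung.IsExponent φ epsBar α) (hα_pos : 0 < α)
    (hC_pos : 0 < FenchelYoung.constC φ epsBar α)
    (ε : ℝ) (hε : ε ∈ Set.Ioo (0 : ℝ) epsBar)
    (T : ℕ)
    (hT : FenchelYoung.blockCount α (FenchelYoung.constC φ epsBar α) γ m η Cg ε *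
        FenchelYoung.blockLength
          (FenchelYoung.lossBound (FenchelYoung.loss φ) m Cg η γ) δ ε < (T : ℝ)) :
    (1 - δ) ^ FenchelYoung.blockCount α (FenchelYoung.constC φ epsBar α) γ m η Cg ε ≤
      P.real {ω | ∃ t ∈ Finset.Icc 1 T,
        FenchelYoung.expectedLoss P (FenchelYoung.loss φ) x y t
          (FenchelYoung.sgd (FenchelYoung.loss φ) η (fun s => x s ω) (fun s => y s ω) t) ≤ ε} := by

  classical
  have h := hloss.potential
  have hm0 := hm.1.2 m le_rfl
  have hℓ := h.continuous_loss hm0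
  have hγ := hdata.margin_pos
  have hε0 := hε.1
  have hmp := hm.1.1
  have hCg := hloss.Cg_pos
  set ℓ := FenchelYoung.loss φ
  set B := (4 * m + η * Cg) / γ
  set a := FenchelYoung.constC φ epsBar α * (ε / 2) ^ α with ha_def
  have ha0 : 0 < a := by positivity
  have ha : ∀ z, ε / 2 ≤ ℓ z → a ≤ FenchelYoung.absSlope ℓ z := fun z hz =>
    h.constC_mul_rpow_le hm0 hα hα_pos hC_pos (by positivity) (by linarith [hε.2]) hz
  set N := FenchelYoung.blockCount α (FenchelYoung.constC φ epsBar α) γ m η Cg ε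
  have hN : N = (4 * m / η + Cg) / (γ ^ 2 * a) := FenchelYoung.blockCount_eq hε0
  -- Needed for `⌊N⌋ + 1 ≤ 2 N`. It holds since `γ ≤ 1` and `a`, a lower bound for an actual slope,
  -- is at most `Cg`.
  have hN1 : 1 ≤ N := by
    rw [hN, one_le_div (by positivity)]
    obtain ⟨z, hz⟩ := h.exists_loss_eq hm0 (c := ε / 2) (by positivity)
    calc γ ^ 2 * a ≤ 1 * a := by
          gcongr
          exact pow_le_one₀ hγ.le hdata.margin_le_one
      _ ≤ Cg := by rw [one_mul]; exact (ha z hz.ge).trans (hloss.lipschitz z)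
      _ ≤ 4 * m / η + Cg := le_add_of_nonneg_left (by positivity)
  have hbounds : ∀ᵐ ω ∂P, ∀ t, γ ^ 2 * (η * ∑ s ∈ Finset.range t, FenchelYoung.absSlope ℓ
      (inner ℝ (FenchelYoung.sgd ℓ η (fun s => x s ω) (fun s => y s ω) s) (y s ω • x s ω))) ≤
        4 * m + η * Cg ∧
      ‖FenchelYoung.sgd ℓ η (fun s => x s ω) (fun s => y s ω) t‖ ≤ B := by
    filter_upwards [hdata.ae_good] with ω ⟨h1, h2, h3⟩ t
    exact hloss.sgd_bounds hm hη hγ hdata.norm_wStar h1 h2 h3 t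
  simp only [hdata.expectedLoss_eq hℓ]
  -- If `M < ε`, the ratio `ε / (2 M)` exceeds `1 / 2` and the comparison with trials is not
  -- available, but then the risk at `t = 1` is already at most `ε` almost surely.
  rcases lt_or_ge (ℓ (-B)) ε with hM | hM
  · have hT1 : 1 ≤ T := by
      have h1 : (1 : ℝ) < T := lt_of_le_of_lt (one_le_mul_of_one_le_of_one_le hN1 (le_max_left _ _)) hT
      exact_mod_cast h1.le
    refine (Real.rpow_le_one (by linarith [hδ.2]) (by linarith [hδ.1]) (by linarith)).trans ?_
    rw [← probReal_univ (μ := P)]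
    refine ENNReal.toReal_mono (measure_ne_top _ _) (measure_mono_ae ?_)
    filter_upwards [hbounds] with ω hω _
    have hprob : IsProbabilityMeasure (P.map fun ω => (x 0 ω, y 0 ω)) :=
      Measure.isProbabilityMeasure_map (hdata.measurable_sample 0).aemeasurable
    refine ⟨1, Finset.mem_Icc.2 ⟨le_rfl, hT1⟩, ?_⟩
    calc _ ≤ ∫ _, ℓ (-B) ∂(P.map fun ω => (x 0 ω, y 0 ω)) :=
          integral_mono_of_nonneg (ae_of_all _ fun z => h.loss_nonneg _) (integrable_const _)
            (hdata.ae_sampleLoss_le h hm0 (hω 1).2)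
      _ ≤ ε := by simpa using hM.le
  refine (FenchelYoung.rpow_le_binomialTail hδ hε0 hM hN1 hT).trans
    ((hdata.binomialTail_le h hm0 hε0 hM (⌊N⌋₊ + 1) T (η := η)).trans ?_)
  refine ENNReal.toReal_mono (measure_ne_top _ _) (measure_mono_ae ?_)
  filter_upwards [hbounds] with ω hω hk
  by_contra hA
  have hA' : ∀ t ∈ Finset.Icc 1 T, ε < FenchelYoung.populationRisk (P.map fun ω => (x 0 ω, y 0 ω)) ℓ
      (FenchelYoung.sgd ℓ η (fun s => x s ω) (fun s => y s ω) t) := by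
    intro t ht
    by_contra! hle
    exact hA ⟨t, ht, hle⟩
  have hcount := h.sgdState_snd_mul_le hm0 (k := ⌊N⌋₊ + 1) ha (fun t => (hω t).2) hA'
  have hk' : N < (FenchelYoung.sgdState (P.map fun ω => (x 0 ω, y 0 ω)) ℓ η ε B (⌊N⌋₊ + 1)
      (fun s => x s ω) (fun s => y s ω) (T + 1)).2 :=
    lt_of_lt_of_le (Nat.lt_floor_add_one N) (by exact_mod_cast hk)
  have hsum := (mul_lt_mul_of_pos_right hk' ha0).trans_le hcount
  have hlt := mul_lt_mul_of_pos_left hsum (by positivity : 0 < γ ^ 2 * η)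
  -- More than `N` counted samples, each of slope at least `a`, overspend the perceptron budget.
  have hNe : γ ^ 2 * η * (N * a) = 4 * m + η * Cg := by
    rw [hN]
    field_simp
  have := (hω (T + 1)).1
  rw [hNe, mul_assoc] at hlt
  exact absurd this (not_le.2 hlt)
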